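/- Let $n\ge 1$ and $1<p<\infty$. For $x\in\mathbb R^n$, $t\in\mathbb R$ and $L>0$ let $Q(x,L)=\{y\in\mathbb R^n: |y_i-x_i|\le L/2,\ i=1,\dots,n\}$, and let $R=R(x,t,L)=Q(x,L)\times(t-L^p,t+L^p)\subset\mathbb R^{n+1}$ be the corresponding parabolic rectangle. For $0\le\gamma<1$ put $$R^-(\gamma)=Q(x,L)\times(t-L^p,\,t-\gamma L^p),\qquad R^+(\gamma)=Q(x,L)\times(t+\gamma L^p,\,t+L^p),\qquad R^\pm=R^\pm(0),$$ $$\tfrac12R^+(\gamma)=Q\bigl(x,\tfrac L2\bigr)\times\Bigl(t+\tfrac{1+\gamma}2L^p-\tfrac{1-\gamma}2\tfrac{L^p}{2^p},\ t+\tfrac{1+\gamma}2L^p+\tfrac{1-\gamma}2\tfrac{L^p}{2^p}\Bigr).$$ A weight is a nonnegative locally integrable function $w$ on $\mathbb R^{n+1}$; write $w(E)=\int_E w$, and $\langle f\rangle_E=\frac1{|E|}\int_E f$. **Theorem.** Let $1<q<\infty$ and $0<\gamma<1$, and let $w$ be a weight such that (i) $w\in RH^+_q$, that is, there is a constant $C>0$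 with $$\bigl(\langle w^q\rangle_{R^-}\bigr)^{1/q}\le C\,\langle w\rangle_{R^+}\quad\text{for every parabolic rectangle }R\subset\mathbb R^{n+1};$$ (ii) $w$ is forward in time parabolic doubling with time lag $\gamma$, that is, there is a constant $c_d>0$ with $$w(R^-(\gamma))\le c_d\,w\bigl(\tfrac12R^+(\gamma)\bigr)\quad\text{for every parabolic rectangle }R\subset\mathbb R^{n+1}.$$ Then $w$ belongs to the parabolic Muckenhoupt class $A^+_r(\gamma)$ for some $1<r<\infty$, that is, $$\sup_{R\subset\mathbb R^{n+1}}\langle w\rangle_{R^-(\gamma)}\,\Bigl(\bigl\langle w^{\frac1{1-r}}\bigr\rangle_{R^+(\gamma)}\Bigr)^{r-1}<\infty,$$ where the supremum is over all parabolic rectangles, with the conventions $0^{1/(1-r)}=\infty$ and $0\cdot\infty=0$. -/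

import Mathlib

open MeasureTheory Set
open scoped ENNReal

noncomputable section

/-- The closed spatial cube `Q(x, L)` in `ℝⁿ` with center `x` and side length `L`. -/
def spatialCube {n : ℕ} (x : Fin n → ℝ) (L : ℝ) : Set (Fin n → ℝ) :=
  {y | ∀ i, |y i - x i| ≤ L / 2}

/-- The lower part `R⁻(γ) = Q(x, L) × (t - L ^ p, t - γ L ^ p)` of the parabolic rectangle
`R(x, t, L)`. The lower part `R⁻` without time lag is the case `γ = 0`. -/
def lowerPart {n : ℕ} (p γ : ℝ) (x : Fin n → ℝ) (t L : ℝ) : Set ((Fin n → ℝ) × ℝ) :=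
  spatialCube x L ×ˢ Ioo (t - L ^ p) (t - γ * L ^ p)

/-- The upper part `R⁺(γ) = Q(x, L) × (t + γ L ^ p, t + L ^ p)` of the parabolic rectangle
`R(x, t, L)`. The upper part `R⁺` without time lag is the case `γ = 0`. -/
def upperPart {n : ℕ} (p γ : ℝ) (x : Fin n → ℝ) (t L : ℝ) : Set ((Fin n → ℝ) × ℝ) :=
  spatialCube x L ×ˢ Ioo (t + γ * L ^ p) (t + L ^ p)

/-- The half-dilate `½R⁺(γ)`: the rectangle with the same center as `R⁺(γ)`, spatial side length
`L / 2` and time length `(1 - γ) (L / 2) ^ p`. -/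
def halfUpperPart {n : ℕ} (p γ : ℝ) (x : Fin n → ℝ) (t L : ℝ) : Set ((Fin n → ℝ) × ℝ) :=
  spatialCube x (L / 2) ×ˢ
    Ioo (t + (1 + γ) / 2 * L ^ p - (1 - γ) / 2 * (L ^ p / 2 ^ p))
      (t + (1 + γ) / 2 * L ^ p + (1 - γ) / 2 * (L ^ p / 2 ^ p))

/-- A weight is a nonnegative locally integrable function on `ℝⁿ × ℝ`. -/
structure IsWeight {n : ℕ} (w : (Fin n → ℝ) × ℝ → ℝ) : Prop where
  nonneg : ∀ z, 0 ≤ w z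
  locallyIntegrable : LocallyIntegrable w volume

/-- The mass `w(E) = ∫_E w` of a set `E`. -/
def weightMass {n : ℕ} (w : (Fin n → ℝ) × ℝ → ℝ) (E : Set ((Fin n → ℝ) × ℝ)) : ℝ≥0∞ :=
  ∫⁻ z in E, ENNReal.ofReal (w z)

/-- The parabolic reverse Hölder class `RH⁺_q`. Integral averages are taken in `[0, ∞]`, so the
inequality contains the finiteness of the left-hand side. -/
def MemParabolicRH {n : ℕ} (p q : ℝ) (w : (Fin n → ℝ) × ℝ → ℝ) : Prop :=
  IsWeight w ∧ ∃ C : ℝ, 0 < C ∧ ∀ (x : Fin n → ℝ) (t L : ℝ), 0 < L →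
    (⨍⁻ z in lowerPart p 0 x t L, ENNReal.ofReal (w z) ^ q ∂volume) ^ (1 / q) ≤
      ENNReal.ofReal C * ⨍⁻ z in upperPart p 0 x t L, ENNReal.ofReal (w z) ∂volume

/-- The forward in time parabolic doubling condition with time lag `γ`:
`w(R⁻(γ)) ≤ c_d w(½R⁺(γ))` for every parabolic rectangle `R`. -/
def IsForwardDoubling {n : ℕ} (p γ : ℝ) (w : (Fin n → ℝ) × ℝ → ℝ) : Prop :=
  ∃ c : ℝ, 0 < c ∧ ∀ (x : Fin n → ℝ) (t L : ℝ), 0 < L →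
    weightMass w (lowerPart p γ x t L) ≤
      ENNReal.ofReal c * weightMass w (halfUpperPart p γ x t L)

/-- The constant `[w]_{A⁺_r(γ)}`, a supremum in `[0, ∞]` over all parabolic rectangles.
Here `0 ^ (1 / (1 - r)) = ∞` for `r > 1`, and `0 * ∞ = 0`. -/
def muckenhouptConst {n : ℕ} (p r γ : ℝ) (w : (Fin n → ℝ) × ℝ → ℝ) : ℝ≥0∞ :=
  ⨆ (x : Fin n → ℝ) (t : ℝ) (L : ℝ) (_ : 0 < L),
    (⨍⁻ z in lowerPart p γ x t L, ENNReal.ofReal (w z) ∂volume) *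
      (⨍⁻ z in upperPart p γ x t L, ENNReal.ofReal (w z) ^ (1 / (1 - r)) ∂volume) ^ (r - 1)

/-- The parabolic Muckenhoupt class `A⁺_r(γ)`. -/
def MemParabolicMuckenhoupt {n : ℕ} (p r γ : ℝ) (w : (Fin n → ℝ) × ℝ → ℝ) : Prop :=
  IsWeight w ∧ muckenhouptConst p r γ w < ∞

end

/-! The weight cannot be small on much of R⁺(γ) when its average W over R⁻(γ) is large: the sets {w
< κW/K^m} fill at most a fraction Cθ^m of R⁺(γ), with θ < 1 (`exists_volume_sublevel_le`). Summing
over the layers between consecutive levels bounds the average of w^(-δ) over R⁺(γ) by a multiple of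
W^(-δ) once K^δ θ < 1 (`setLIntegral_rpow_neg_le`). This is the Muckenhoupt condition with r = 1 +
1/δ.

For the decay, attach to each point z the boxes of size ℓ centered A ℓ^p before z. As ℓ halves they
advance in time towards z, so forward doubling compares the mass of each box with that of the next
(`exists_pastBox_estimates`), and the mass of R⁻(γ) with that of the first
(`exists_measure_lowerPart_le_pastBox`). Reverse Hölder, followed by doubling from R⁺ to the next
box, shows that a subset of small relative volume carries at most half the mass of the next box.

For almost every z with w(z) < l, arbitrarily small boxes have average at most 2l
(`ae_exists_withDensity_pastBox_le`), whereas the mass of the first box is large. The averages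
cannot drop without some box having a fixed fraction of its volume in {l ≤ w < Kl}
(`exists_lt_measure_inter_level`). A Vitali covering (`exists_volume_le_of_pastBox`) then bounds the
volume of a sublevel set by that of the layer just above it in a slightly larger region, and
iteration gives the decay. -/

/-! ### Parabolic boxes and their volumes. -/

/-- The parabolic box `Q(x, ℓ) × (s - β ℓ ^ p, s + β ℓ ^ p)`. -/
def timeBox {n : ℕ} (p β : ℝ) (x : Fin n → ℝ) (s ℓ : ℝ) : Set ((Fin n → ℝ) × ℝ) :=
  spatialCube x ℓ ×ˢ Ioo (s - β * ℓ ^ p) (s + β * ℓ ^ p)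

/-- The box `timeBox` of size `ℓ` whose center precedes `z` by the time lag `A ℓ ^ p`. -/
def pastBox {n : ℕ} (p β A : ℝ) (z : (Fin n → ℝ) × ℝ) (ℓ : ℝ) : Set ((Fin n → ℝ) × ℝ) :=
  timeBox p β z.1 (z.2 - A * ℓ ^ p) ℓ

lemma spatialCube_eq_closedBall {n : ℕ} (x : Fin n → ℝ) {L : ℝ} (hL : 0 ≤ L) :
    spatialCube x L = Metric.closedBall x (L / 2) := by
  ext y
  simp [spatialCube, dist_pi_le_iff (by positivity : 0 ≤ L / 2), Real.dist_eq]

lemma measurableSet_spatialCube {n : ℕ} (x : Fin n → ℝ) (L : ℝ) :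
    MeasurableSet (spatialCube x L) := by
  have : spatialCube x L = ⋂ i, {y : Fin n → ℝ | |y i - x i| ≤ L / 2} := by
    ext y; simp [spatialCube]
  rw [this]
  refine MeasurableSet.iInter fun i => ?_
  exact measurableSet_le (by fun_prop) (by fun_prop)

lemma volume_spatialCube_prod {n : ℕ} (x : Fin n → ℝ) {L : ℝ} (hL : 0 ≤ L) (a b : ℝ) :
    volume (spatialCube x L ×ˢ Ioo a b) = ENNReal.ofReal (L ^ n * (b - a)) := by
  rw [Measure.volume_eq_prod, Measure.prod_prod, spatialCube_eq_closedBall x hL,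
    Real.volume_pi_closedBall _ (by positivity), Real.volume_Ioo,
    ENNReal.ofReal_mul (by positivity)]
  simp [mul_div_cancel₀]

lemma measurableSet_timeBox {n : ℕ} (p β : ℝ) (x : Fin n → ℝ) (s ℓ : ℝ) :
    MeasurableSet (timeBox p β x s ℓ) :=
  (measurableSet_spatialCube x ℓ).prod measurableSet_Ioo

lemma measurableSet_pastBox {n : ℕ} (p β A : ℝ) (z : (Fin n → ℝ) × ℝ) (ℓ : ℝ) :
    MeasurableSet (pastBox p β A z ℓ) :=
  measurableSet_timeBox _ _ _ _ _

lemma volume_pastBox {n : ℕ} (p β A : ℝ) (z : (Fin n → ℝ) × ℝ) {ℓ : ℝ} (hℓ : 0 ≤ ℓ) :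
    volume (pastBox p β A z ℓ) = ENNReal.ofReal (ℓ ^ n * (2 * β * ℓ ^ p)) := by
  rw [pastBox, timeBox, volume_spatialCube_prod _ hℓ]
  congr 1; ring

lemma volume_pastBox_ne_top {n : ℕ} (p β A : ℝ) (z : (Fin n → ℝ) × ℝ) {ℓ : ℝ} (hℓ : 0 ≤ ℓ) :
    volume (pastBox p β A z ℓ) ≠ ⊤ := by
  rw [volume_pastBox _ _ _ _ hℓ]; exact ENNReal.ofReal_ne_top

lemma volume_pastBox_mono {n : ℕ} {p β A : ℝ} (hp : 0 ≤ p) (hβ : 0 ≤ β) (z : (Fin n → ℝ) × ℝ)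
    {ℓ ℓ' : ℝ} (hℓ : 0 ≤ ℓ) (h : ℓ ≤ ℓ') :
    volume (pastBox p β A z ℓ) ≤ volume (pastBox p β A z ℓ') := by
  rw [volume_pastBox _ _ _ _ hℓ, volume_pastBox _ _ _ _ (hℓ.trans h)]
  apply ENNReal.ofReal_le_ofReal
  have := Real.rpow_le_rpow hℓ h hp
  have := Real.rpow_nonneg hℓ p
  have := hℓ.trans h
  gcongr

/-! ### Chains of boxes forward in time. -/

section Chain

variable {n : ℕ} {p γ : ℝ} {ν : Measure ((Fin n → ℝ) × ℝ)} {c : ℝ≥0∞}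

/-- Doubling for a rectangle of side 2ℓ: its half upper part is exactly the later box, and its lower
part is larger than a box of size ℓ. The difference in size is the slack allowed in the position of
the earlier box. -/
lemma measure_timeBox_le_of_near
    (hd : ∀ (x : Fin n → ℝ) (t L : ℝ), 0 < L →
      ν (lowerPart p γ x t L) ≤ c * ν (halfUpperPart p γ x t L))
    {ℓ : ℝ} (hℓ : 0 < ℓ) {x x' : Fin n → ℝ} {s s' : ℝ} (hx : ∀ i, |x i - x' i| ≤ ℓ / 2)
    (hs : |s - s' - (1 + γ) * 2 ^ p * ℓ ^ p| ≤ (1 - γ) / 2 * (2 ^ p - 1) * ℓ ^ p) :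
    ν (timeBox p ((1 - γ) / 2) x' s' ℓ) ≤ c * ν (timeBox p ((1 - γ) / 2) x s ℓ) := by
  have h2 : (2 * ℓ) ^ p = 2 ^ p * ℓ ^ p := Real.mul_rpow (by norm_num) hℓ.le
  have h2p : (0 : ℝ) < 2 ^ p := by positivity
  have key := hd x (s - (1 + γ) / 2 * (2 ^ p * ℓ ^ p)) (2 * ℓ) (by positivity)
  have e : halfUpperPart p γ x (s - (1 + γ) / 2 * (2 ^ p * ℓ ^ p)) (2 * ℓ)
      = timeBox p ((1 - γ) / 2) x s ℓ := by
    rw [halfUpperPart, timeBox, h2, mul_div_cancel_left₀ _ h2p.ne', mul_div_cancel_left₀ _ two_ne_zero]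
    congr 2 <;> ring
  rw [e] at key
  refine (measure_mono ?_).trans key
  rintro ⟨y, u⟩ ⟨hy, hu⟩
  simp only [spatialCube, mem_ofPred_eq, mem_Ioo] at hy hu
  rw [abs_le] at hs
  refine ⟨fun i => ?_, ?_, ?_⟩
  · have h1 := abs_le.1 (hy i)
    have h3 := abs_le.1 (hx i)
    rw [abs_le]; constructor <;> dsimp only <;> linarith
  · rw [h2]; dsimp only; nlinarith
  · rw [h2]; dsimp only; nlinarith

lemma measure_timeBox_le_pow
    (hd : ∀ (x : Fin n → ℝ) (t L : ℝ), 0 < L →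
      ν (lowerPart p γ x t L) ≤ c * ν (halfUpperPart p γ x t L))
    {ℓ : ℝ} (hℓ : 0 < ℓ) (k : ℕ) (x x' : Fin n → ℝ) (s s' : ℝ)
    (hx : ∀ i, |x i - x' i| ≤ k * (ℓ / 2))
    (hs : |s - s' - k * ((1 + γ) * 2 ^ p * ℓ ^ p)| ≤ k * ((1 - γ) / 2 * (2 ^ p - 1) * ℓ ^ p)) :
    ν (timeBox p ((1 - γ) / 2) x' s' ℓ) ≤ c ^ k * ν (timeBox p ((1 - γ) / 2) x s ℓ) := by
  induction k generalizing x s with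
  | zero =>
    have hx' : x = x' := by
      ext i
      have := hx i
      simp only [Nat.cast_zero, zero_mul, abs_nonpos_iff] at this
      linarith
    have hs' : s = s' := by
      simp only [Nat.cast_zero, zero_mul, sub_zero, abs_nonpos_iff] at hs
      linarith
    simp [hx', hs']
  | succ k ih =>
    have hk : (0 : ℝ) < (k : ℝ) + 1 := by positivity
    push_cast at hx hs
    -- The chain follows the segment from (x', s') to (x, s) in equal steps, so both tolerances
    -- divide evenly; the last intermediate center is at the fraction k / (k + 1).
    set r : ℝ := k / (k + 1) with hr
    have hr0 : 0 ≤ r := by positivity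
    have hrk : r * (k + 1) = k := by rw [hr]; field_simp
    have hr1 : (1 - r) * (k + 1) = 1 := by linarith
    have hr1' : 0 ≤ 1 - r := by nlinarith
    have h1 := ih (fun i => x' i + r * (x i - x' i)) (s' + r * (s - s'))
      (fun i => by
        have : x' i + r * (x i - x' i) - x' i = r * (x i - x' i) := by ring
        rw [this, abs_mul, abs_of_nonneg hr0, ← hrk, mul_assoc]
        exact mul_le_mul_of_nonneg_left (hx i) hr0)
      (by
        have : s' + r * (s - s') - s' - k * ((1 + γ) * 2 ^ p * ℓ ^ p)
            = r * (s - s' - (k + 1) * ((1 + γ) * 2 ^ p * ℓ ^ p)) := by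
          linear_combination ((1 + γ) * 2 ^ p * ℓ ^ p) * hrk
        rw [this, abs_mul, abs_of_nonneg hr0]
        refine (mul_le_mul_of_nonneg_left hs hr0).trans_eq ?_
        rw [← mul_assoc, hrk])
    refine h1.trans ?_
    rw [pow_succ, mul_assoc]
    gcongr
    refine measure_timeBox_le_of_near hd hℓ (fun i => ?_) ?_
    · have : x i - (x' i + r * (x i - x' i)) = (1 - r) * (x i - x' i) := by ring
      rw [this, abs_mul, abs_of_nonneg hr1']
      refine (mul_le_mul_of_nonneg_left (hx i) hr1').trans_eq ?_
      rw [← mul_assoc, hr1, one_mul]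
    · have : s - (s' + r * (s - s')) - (1 + γ) * 2 ^ p * ℓ ^ p
            = (1 - r) * (s - s' - (k + 1) * ((1 + γ) * 2 ^ p * ℓ ^ p)) := by
          linear_combination ((1 + γ) * 2 ^ p * ℓ ^ p) * hr1
      rw [this, abs_mul, abs_of_nonneg hr1']
      refine (mul_le_mul_of_nonneg_left hs hr1').trans_eq ?_
      rw [← mul_assoc, hr1, one_mul]

/-- The floor of the lag over one step length leaves a remainder below one step. The slack of the
steps adds up, and after `M` steps it exceeds that remainder, so no lag beyond `M` steps is missed.
-/
lemma measure_timeBox_le_of_lag (hγ0 : 0 < γ) (hγ1 : γ < 1) (hc : 1 ≤ c)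
    (hd : ∀ (x : Fin n → ℝ) (t L : ℝ), 0 < L →
      ν (lowerPart p γ x t L) ≤ c * ν (halfUpperPart p γ x t L))
    {ℓ : ℝ} (hℓ : 0 < ℓ) {M N : ℕ}
    (hM : (1 + γ) * 2 ^ p ≤ M * ((1 - γ) / 2 * (2 ^ p - 1))) (hp : 0 < p)
    {x x' : Fin n → ℝ} {s s' : ℝ}
    (hx : ∀ i, |x i - x' i| ≤ M * (ℓ / 2))
    (hs : M * ((1 + γ) * 2 ^ p * ℓ ^ p) ≤ s - s') (hs' : s - s' ≤ N * ((1 + γ) * 2 ^ p * ℓ ^ p)) :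
    ν (timeBox p ((1 - γ) / 2) x' s' ℓ) ≤ c ^ N * ν (timeBox p ((1 - γ) / 2) x s ℓ) := by
  set α : ℝ := (1 + γ) * 2 ^ p with hα
  have hℓp : 0 < ℓ ^ p := Real.rpow_pos_of_pos hℓ p
  have h2 : (1 : ℝ) < 2 ^ p := Real.one_lt_rpow (by norm_num) hp
  have hα0 : 0 < α := by positivity
  have hαℓ : 0 < α * ℓ ^ p := by positivity
  set k := ⌊(s - s') / (α * ℓ ^ p)⌋₊ with hk
  have hMk : M ≤ k := Nat.le_floor (by rw [le_div_iff₀ hαℓ]; exact hs)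
  have hMk' : (M : ℝ) ≤ k := by exact_mod_cast hMk
  have hss : 0 ≤ s - s' := le_trans (by positivity) hs
  have hkN : k ≤ N := Nat.floor_le_of_le (by rw [div_le_iff₀ hαℓ]; exact hs')
  have h1 : k * (α * ℓ ^ p) ≤ s - s' := by
    rw [← le_div_iff₀ hαℓ]; exact Nat.floor_le (by positivity)
  have h3 : s - s' < (k + 1) * (α * ℓ ^ p) := by
    rw [← div_lt_iff₀ hαℓ]; exact Nat.lt_floor_add_one _
  refine (measure_timeBox_le_pow hd hℓ k x x' s s' (fun i => (hx i).trans ?_) ?_).trans ?_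
  · gcongr
  · rw [abs_of_nonneg (by linarith)]
    have h4 : (M : ℝ) * ((1 - γ) / 2 * (2 ^ p - 1)) ≤ k * ((1 - γ) / 2 * (2 ^ p - 1)) := by
      have : 0 ≤ (1 - γ) / 2 * ((2 : ℝ) ^ p - 1) := by
        apply mul_nonneg <;> linarith
      gcongr
    have := mul_le_mul_of_nonneg_right (hM.trans h4) hℓp.le
    linarith
  · gcongr

/-- Compactness in coordinates rescaled by L in space and L^p in time; thus one finite set of
centers serves all positions and scales. -/
lemma exists_finset_cover_timeBox (n : ℕ) {p β ε : ℝ} (hε : 0 < ε) (hβ : 0 < β) (a b : ℝ) :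
    ∃ F : Finset ((Fin n → ℝ) × ℝ), (∀ f ∈ F, (∀ i, |f.1 i| ≤ a) ∧ |f.2| ≤ b) ∧
      ∀ (x : Fin n → ℝ) (t L : ℝ), 0 < L → ∀ z : (Fin n → ℝ) × ℝ,
        (∀ i, |z.1 i - x i| ≤ a * L) → |z.2 - t| ≤ b * L ^ p →
        ∃ f ∈ F, z ∈ timeBox p β (fun i => x i + L * f.1 i) (t + L ^ p * f.2) (ε * L) := by
  set K : Set ((Fin n → ℝ) × ℝ) := {f | (∀ i, |f.1 i| ≤ a) ∧ |f.2| ≤ b} with hK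
  have hKc : IsCompact K := by
    have : K = Icc ((fun _ => -a : Fin n → ℝ), -b) ((fun _ => a : Fin n → ℝ), b) := by
      ext f
      simp only [hK, abs_le, mem_ofPred_eq, mem_Icc, Prod.le_def, Pi.le_def, forall_and]
      tauto
    rw [this]
    exact isCompact_Icc
  set δ := min (ε / 2) (β * ε ^ p) with hδ
  have hδ0 : 0 < δ := by
    have := Real.rpow_pos_of_pos hε p
    positivity
  obtain ⟨T, hTK, hTf, hT⟩ := finite_cover_balls_of_compact hKc hδ0
  refine ⟨hTf.toFinset, fun f hf => hTK (hTf.mem_toFinset.1 hf), fun x t L hL z hz1 hz2 => ?_⟩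
  have hLp : 0 < L ^ p := Real.rpow_pos_of_pos hL p
  have hmem : ((fun i => (z.1 i - x i) / L, (z.2 - t) / L ^ p) : (Fin n → ℝ) × ℝ) ∈ K := by
    refine ⟨fun i => ?_, ?_⟩
    · rw [abs_div, abs_of_pos hL, div_le_iff₀ hL]; exact hz1 i
    · rw [abs_div, abs_of_pos hLp, div_le_iff₀ hLp]; exact hz2
  obtain ⟨f, hfT, hf⟩ := mem_iUnion₂.1 (hT hmem)
  refine ⟨f, hTf.mem_toFinset.2 hfT, ?_⟩
  rw [Metric.mem_ball, Prod.dist_eq, max_lt_iff, dist_pi_lt_iff hδ0, Real.dist_eq, abs_lt] at hf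
  obtain ⟨hf1, hf2, hf3⟩ := hf
  have hδ1 : δ ≤ ε / 2 := min_le_left _ _
  have hδ2 : δ ≤ β * ε ^ p := min_le_right _ _
  have e2 : z.2 - t = (z.2 - t) / L ^ p * L ^ p := by field_simp
  have e3 : (ε * L) ^ p = ε ^ p * L ^ p := Real.mul_rpow hε.le hL.le
  refine ⟨fun i => ?_, ?_, ?_⟩
  · have h1 := hf1 i
    rw [Real.dist_eq] at h1
    have e1 : z.1 i - (x i + L * f.1 i) = ((z.1 i - x i) / L - f.1 i) * L := by
      field_simp; ring
    rw [e1, abs_mul, abs_of_pos hL]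
    have := mul_le_mul_of_nonneg_right (h1.le.trans hδ1) hL.le
    dsimp only at this
    linarith
  · rw [e3]; dsimp only at hf2 ⊢
    have := mul_lt_mul_of_pos_right hf2 hLp
    have := mul_le_mul_of_nonneg_right hδ2 hLp.le
    linarith
  · rw [e3]; dsimp only at hf3 ⊢
    have := mul_lt_mul_of_pos_right hf3 hLp
    have := mul_le_mul_of_nonneg_right hδ2 hLp.le
    linarith

/-- Cover the early set by boxes of the small size and run a chain from each to the later box. The
maximal lag b' bounds the chain length, so the constant is independent of scale. -/
lemma exists_measure_le_timeBox_of_lag (hγ0 : 0 < γ) (hγ1 : γ < 1) (hp : 0 < p) (hc : 1 ≤ c)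
    (hc' : c ≠ ⊤)
    (hd : ∀ (x : Fin n → ℝ) (t L : ℝ), 0 < L →
      ν (lowerPart p γ x t L) ≤ c * ν (halfUpperPart p γ x t L))
    {ε a a' b : ℝ} (b' : ℝ) (hε : 0 < ε) {M : ℕ}
    (hM : (1 + γ) * 2 ^ p ≤ M * ((1 - γ) / 2 * (2 ^ p - 1))) (hMa : a + a' ≤ M * (ε / 2)) :
    ∃ C : ℝ≥0∞, C ≠ ⊤ ∧ ∀ (x : Fin n → ℝ) (t L : ℝ), 0 < L → ∀ E : Set ((Fin n → ℝ) × ℝ),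
      (∀ z ∈ E, (∀ i, |z.1 i - x i| ≤ a * L) ∧ |z.2 - t| ≤ b * L ^ p) →
      ∀ (y : Fin n → ℝ) (s : ℝ), (∀ i, |y i - x i| ≤ a' * L) →
        b * L ^ p + M * ((1 + γ) * 2 ^ p * (ε * L) ^ p) ≤ s - t → s - t ≤ b' * L ^ p →
        ν E ≤ C * ν (timeBox p ((1 - γ) / 2) y s (ε * L)) := by
  have hβ : 0 < (1 - γ) / 2 := by linarith
  obtain ⟨F, hF, hcov⟩ := exists_finset_cover_timeBox n (p := p) hε hβ a b
  obtain ⟨N, hN⟩ := exists_nat_ge ((b' + b) / ((1 + γ) * 2 ^ p * ε ^ p))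
  have hεp : 0 < ε ^ p := Real.rpow_pos_of_pos hε p
  rw [div_le_iff₀ (by positivity)] at hN
  refine ⟨F.card * c ^ N, by finiteness, fun x t L hL E hE y s hy hs hs' => ?_⟩
  have hLp : 0 < L ^ p := Real.rpow_pos_of_pos hL p
  have e3 : (ε * L) ^ p = ε ^ p * L ^ p := Real.mul_rpow hε.le hL.le
  calc ν E ≤ ν (⋃ f ∈ F, timeBox p ((1 - γ) / 2) (fun i => x i + L * f.1 i) (t + L ^ p * f.2)
        (ε * L)) := measure_mono fun z hz => by
          obtain ⟨f, hf, hz'⟩ := hcov x t L hL z (hE z hz).1 (hE z hz).2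
          exact mem_iUnion₂.2 ⟨f, hf, hz'⟩
    _ ≤ ∑ f ∈ F, ν (timeBox p ((1 - γ) / 2) (fun i => x i + L * f.1 i) (t + L ^ p * f.2)
        (ε * L)) := measure_biUnion_finset_le _ _
    _ ≤ ∑ f ∈ F, c ^ N * ν (timeBox p ((1 - γ) / 2) y s (ε * L)) := by
        refine Finset.sum_le_sum fun f hf => ?_
        obtain ⟨hf1, hf2⟩ := hF f hf
        rw [abs_le] at hf2
        refine measure_timeBox_le_of_lag hγ0 hγ1 hc hd (by positivity) hM hp (fun i => ?_) ?_ ?_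
        · have h1 := abs_le.1 (hf1 i)
          have h2 := abs_le.1 (hy i)
          have h3 := mul_le_mul_of_nonneg_right hMa hL.le
          have h4 := mul_le_mul_of_nonneg_left h1.1 hL.le
          have h5 := mul_le_mul_of_nonneg_left h1.2 hL.le
          rw [abs_le]
          constructor <;> linarith
        · have := mul_le_mul_of_nonneg_left hf2.2 hLp.le
          linarith
        · have h1 := mul_le_mul_of_nonneg_left hf2.1 hLp.le
          have h2 := mul_le_mul_of_nonneg_right hN hLp.le
          rw [e3]
          linarith
    _ = F.card * c ^ N * ν (timeBox p ((1 - γ) / 2) y s (ε * L)) := by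
        rw [Finset.sum_const, nsmul_eq_mul, mul_assoc]

end Chain

/-! ### Vitali covering and differentiation along past boxes. -/

section Covering

variable {n : ℕ} {p β A : ℝ}

/-- Vitali covering for past boxes: if every point of `F` has a past box inside `U` carrying a
proportional amount of `μ`, then the volume of `F` is controlled by `μ U`. -/
lemma exists_volume_le_of_pastBox (n : ℕ) (hp : 0 < p) (hβ : 0 < β) (hA : 0 ≤ A) :
    ∃ C : ℝ≥0∞, C ≠ ⊤ ∧ ∀ (μ : Measure ((Fin n → ℝ) × ℝ)) (F U : Set ((Fin n → ℝ) × ℝ))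
      (c : ℝ≥0∞) (ℓ₀ : ℝ),
      (∀ z ∈ F, ∃ ℓ, 0 < ℓ ∧ ℓ ≤ ℓ₀ ∧ pastBox p β A z ℓ ⊆ U ∧
        volume (pastBox p β A z ℓ) ≤ c * μ (pastBox p β A z ℓ)) →
      volume F ≤ C * (c * μ U) := by
  set C : ℝ := 3 ^ n * ((A + β + 1) * (2 ^ p + 1) / β) with hC
  refine ⟨ENNReal.ofReal C, ENNReal.ofReal_ne_top, fun μ F U c ℓ₀ h => ?_⟩
  choose! ℓ hℓ0 hℓ hU hvol using h
  -- Each hull contains both z and its past box: disjoint hulls give disjoint past boxes, while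
  -- enlarged hulls cover the points z.
  set V : (Fin n → ℝ) × ℝ → Set ((Fin n → ℝ) × ℝ) := fun z =>
    spatialCube z.1 (ℓ z) ×ˢ Icc (z.2 - (A + β) * ℓ z ^ p) (z.2 + (A + β) * ℓ z ^ p) with hV
  have hSV : ∀ z ∈ F, pastBox p β A z (ℓ z) ⊆ V z := by
    rintro z hz y ⟨hy1, hy2, hy3⟩
    have : 0 < ℓ z ^ p := Real.rpow_pos_of_pos (hℓ0 z hz) p
    refine ⟨hy1, by nlinarith, by nlinarith⟩
  have hzV : ∀ z ∈ F, z ∈ V z := by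
    intro z hz
    have h1 : 0 < ℓ z ^ p := Real.rpow_pos_of_pos (hℓ0 z hz) p
    have h2 := hℓ0 z hz
    refine ⟨fun i => by simp only [sub_self, abs_zero]; positivity, ?_, ?_⟩ <;> nlinarith
  obtain ⟨u, huF, hdisj, hu⟩ := Vitali.exists_disjoint_subfamily_covering_enlargement V F ℓ 2
    (by norm_num) (fun z hz => (hℓ0 z hz).le) ℓ₀ hℓ (fun z hz => ⟨z, hzV z hz⟩)
  have hcount : u.Countable := by
    refine hdisj.countable_of_nonempty_interior fun z hz => ?_
    have h1 : 0 < ℓ z ^ p := Real.rpow_pos_of_pos (hℓ0 z (huF hz)) p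
    have h2 := hℓ0 z (huF hz)
    rw [interior_prod_eq, spatialCube_eq_closedBall _ h2.le, interior_Icc]
    refine Nonempty.prod ⟨z.1, Metric.ball_subset_interior_closedBall
      (Metric.mem_ball_self (by positivity))⟩ ⟨z.2, ?_, ?_⟩ <;> nlinarith
  -- The factors 3 and 2^p + 1 come from ℓ z ≤ 2 ℓ b for intersecting hulls; the extra 1 gives
  -- strict inequalities in time.
  set W : (Fin n → ℝ) × ℝ → Set ((Fin n → ℝ) × ℝ) := fun z =>
    spatialCube z.1 (3 * ℓ z) ×ˢ Ioo (z.2 - (A + β + 1) * (2 ^ p + 1) * ℓ z ^ p)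
      (z.2 + (A + β + 1) * (2 ^ p + 1) * ℓ z ^ p) with hW
  have hcov : F ⊆ ⋃ z ∈ u, W z := by
    intro z hz
    obtain ⟨b, hbu, ⟨y, ⟨hy1, hy2⟩, hy3, hy4⟩, hzb⟩ := hu z hz
    refine mem_iUnion₂.2 ⟨b, hbu, fun i => ?_, ?_⟩
    · have h1 := abs_le.1 (hy1 i)
      have h2 := abs_le.1 (hy3 i)
      rw [abs_le]; constructor <;> linarith
    · have h1 : ℓ z ^ p ≤ 2 ^ p * ℓ b ^ p := by
        rw [← Real.mul_rpow (by norm_num) (hℓ0 b (huF hbu)).le]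
        exact Real.rpow_le_rpow (hℓ0 z hz).le hzb hp.le
      have h2 : 0 < ℓ b ^ p := Real.rpow_pos_of_pos (hℓ0 b (huF hbu)) p
      have h3 : (A + β) * ℓ z ^ p ≤ (A + β) * (2 ^ p * ℓ b ^ p) := by gcongr
      have h4 : 0 < (2 ^ p + 1) * ℓ b ^ p := by positivity
      rw [mem_Icc] at hy2 hy4
      constructor <;> linarith
  have hWS : ∀ z ∈ u, volume (W z) ≤ ENNReal.ofReal C * volume (pastBox p β A z (ℓ z)) := by
    intro z hz
    have h2 := (hℓ0 z (huF hz)).le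
    rw [volume_pastBox _ _ _ _ h2, hW, volume_spatialCube_prod _ (by positivity),
      ← ENNReal.ofReal_mul (by positivity)]
    apply ENNReal.ofReal_le_ofReal
    rw [hC, mul_pow]
    apply le_of_eq
    field_simp
    ring
  calc volume F ≤ volume (⋃ z ∈ u, W z) := measure_mono hcov
    _ ≤ ∑' z : u, volume (W z) := measure_biUnion_le _ hcount _
    _ ≤ ∑' z : u, ENNReal.ofReal C * (c * μ (pastBox p β A z (ℓ z))) :=
        ENNReal.tsum_le_tsum fun z =>
          (hWS z z.2).trans (mul_le_mul_right (hvol z (huF z.2)) _)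
    _ = ENNReal.ofReal C * (c * μ (⋃ z ∈ u, pastBox p β A z (ℓ z))) := by
        rw [ENNReal.tsum_mul_left, ENNReal.tsum_mul_left, measure_biUnion hcount
          (hdisj.mono_on fun z hz => hSV z (huF hz)) fun z _ => measurableSet_pastBox _ _ _ _ _]
    _ ≤ ENNReal.ofReal C * (c * μ U) := by
        gcongr
        exact iUnion₂_subset fun z hz => hU z (huF hz)

lemma exists_pastBox_subset (hp : 0 < p) {U : Set ((Fin n → ℝ) × ℝ)}
    (hU : IsOpen U) {z : (Fin n → ℝ) × ℝ} (hz : z ∈ U) {ℓ₀ : ℝ} (hℓ₀ : 0 < ℓ₀) :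
    ∃ J : ℕ, ∀ j ≥ J, pastBox p β A z (ℓ₀ / 2 ^ j) ⊆ U := by
  obtain ⟨ε, hε, hball⟩ := Metric.isOpen_iff.1 hU z hz
  have h0 : Filter.Tendsto (fun j : ℕ => ℓ₀ / 2 ^ j) Filter.atTop (nhds 0) := by
    simpa [div_eq_mul_inv] using
      (tendsto_pow_atTop_nhds_zero_of_lt_one (r := (2 : ℝ)⁻¹) (by norm_num) (by norm_num)).const_mul ℓ₀
  have h1 : Filter.Tendsto (fun j : ℕ => (|A| + |β|) * (ℓ₀ / 2 ^ j) ^ p) Filter.atTop (nhds 0) := by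
    have := (h0.rpow_const (p := p) (Or.inr hp.le)).const_mul (|A| + |β|)
    rwa [Real.zero_rpow hp.ne', mul_zero] at this
  obtain ⟨J, hJ⟩ := Filter.eventually_atTop.1 ((h0.eventually_lt_const hε).and
    (h1.eventually_lt_const hε))
  refine ⟨J, fun j hj y hy => hball ?_⟩
  obtain ⟨hj0, hj1⟩ := hJ j hj
  obtain ⟨hy1, hy2, hy3⟩ := hy
  have hℓ : 0 < ℓ₀ / 2 ^ j := by positivity
  have hℓp : 0 < (ℓ₀ / 2 ^ j) ^ p := Real.rpow_pos_of_pos hℓ p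
  have e1 := mul_le_mul_of_nonneg_right (le_abs_self A) hℓp.le
  have e2 := mul_le_mul_of_nonneg_right (neg_abs_le A) hℓp.le
  have e3 := mul_le_mul_of_nonneg_right (le_abs_self β) hℓp.le
  rw [Metric.mem_ball, Prod.dist_eq, max_lt_iff, dist_pi_lt_iff hε, Real.dist_eq, abs_lt]
  refine ⟨fun i => ?_, ?_, ?_⟩
  · rw [Real.dist_eq]
    exact (hy1 i).trans_lt (by linarith)
  · linarith
  · linarith

/-- One-sided Lebesgue differentiation along past boxes. -/
lemma ae_exists_withDensity_pastBox_le (hp : 0 < p) (hβ : 0 < β) (hA : 0 ≤ A)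
    {v : (Fin n → ℝ) × ℝ → ℝ≥0∞} (hv : Measurable v) [IsLocallyFiniteMeasure (volume.withDensity v)]
    {l : ℝ≥0∞} (hl0 : l ≠ 0) (hl : l ≠ ⊤) {ℓ₀ : ℝ} (hℓ₀ : 0 < ℓ₀) :
    ∀ᵐ z, v z < l → ∀ J : ℕ, ∃ j ≥ J, volume.withDensity v (pastBox p β A z (ℓ₀ / 2 ^ j)) ≤
      2 * l * volume (pastBox p β A z (ℓ₀ / 2 ^ j)) := by
  suffices H : ∀ J : ℕ, ∀ᵐ z, v z < l → ∃ j ≥ J,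
      volume.withDensity v (pastBox p β A z (ℓ₀ / 2 ^ j)) ≤
      2 * l * volume (pastBox p β A z (ℓ₀ / 2 ^ j)) by
    filter_upwards [ae_all_iff.2 H] with z hz hvz J using hz J hvz
  intro J
  obtain ⟨C, hC, hcov⟩ := exists_volume_le_of_pastBox n hp hβ hA
  -- The excess of v over l gives no mass to the exceptional set, hence little mass to some open
  -- neighborhood. A box of average above 2l has excess at least l times its volume, so the covering
  -- lemma makes the exceptional set null.
  set μ : Measure ((Fin n → ℝ) × ℝ) := volume.withDensity fun z => v z - l with hμ
  have hμv : μ ≤ volume.withDensity v := withDensity_mono (ae_of_all _ fun z => tsub_le_self)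
  have : IsLocallyFiniteMeasure μ := Measure.isLocallyFiniteMeasure_of_le hμv
  rw [ae_iff]
  set F := {z | ¬(v z < l → ∃ j ≥ J, volume.withDensity v (pastBox p β A z (ℓ₀ / 2 ^ j)) ≤
      2 * l * volume (pastBox p β A z (ℓ₀ / 2 ^ j)))} with hF
  have hμF : μ F = 0 := by
    rw [hμ, withDensity_apply_eq_zero (by fun_prop)]
    convert measure_empty (μ := (volume : Measure ((Fin n → ℝ) × ℝ)))
    ext z
    simp only [hF, mem_inter_iff, mem_ofPred_eq, Classical.not_imp, mem_empty_iff_false, iff_false]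
    exact fun h => h.1 (tsub_eq_zero_of_le h.2.1.le)
  have hle : ∀ ε : ℝ≥0∞, ε ≠ 0 → volume F ≤ C * (l⁻¹ * ε) := by
    intro ε hε
    obtain ⟨U, hFU, hUo, hU⟩ := F.exists_isOpen_le_add μ hε
    rw [hμF, zero_add] at hU
    refine (hcov μ F U l⁻¹ ℓ₀ fun z hz => ?_).trans (by gcongr)
    obtain ⟨J', hJ'⟩ := exists_pastBox_subset (p := p) (β := β) (A := A) hp hUo (hFU hz) hℓ₀
    have hz' := hz
    rw [hF] at hz'
    simp only [mem_ofPred_eq, Classical.not_imp, not_exists, not_and, not_le] at hz'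
    have hlt := hz'.2 (max J J') (le_max_left _ _)
    have hℓ : 0 < ℓ₀ / 2 ^ (max J J') := by positivity
    refine ⟨ℓ₀ / 2 ^ (max J J'), hℓ, div_le_self hℓ₀.le (one_le_pow₀ (by norm_num)),
      hJ' _ (le_max_right _ _), ?_⟩
    set S := pastBox p β A z (ℓ₀ / 2 ^ (max J J')) with hS
    have hSfin : volume S ≠ ⊤ := volume_pastBox_ne_top _ _ _ _ hℓ.le
    have h1 : volume.withDensity v S ≤ μ S + l * volume S := by
      rw [hμ, withDensity_apply', withDensity_apply', ← setLIntegral_const,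
        ← lintegral_add_right _ measurable_const]
      exact lintegral_mono fun y => le_tsub_add
    have h2 : l * volume S ≤ μ S := by
      have h3 := hlt.le.trans h1
      rw [two_mul, add_mul] at h3
      exact (ENNReal.add_le_add_iff_right (by finiteness)).1 h3
    rw [mul_comm, ← div_eq_mul_inv, ENNReal.le_div_iff_mul_le (Or.inl hl0) (Or.inl hl), mul_comm]
    exact h2
  have hll : l⁻¹ ≠ ⊤ := by simpa using hl0
  refine nonpos_iff_eq_zero.1 (ENNReal.le_of_forall_pos_le_add fun ε hε _ => ?_)
  rw [zero_add]
  refine (hle (ε / (C * l⁻¹ + 1)) (by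
    simp only [ne_eq, ENNReal.div_eq_zero_iff, ENNReal.coe_eq_zero, hε.ne', false_or]
    finiteness)).trans ?_
  rw [← mul_assoc]
  calc C * l⁻¹ * (ε / (C * l⁻¹ + 1)) ≤ (C * l⁻¹ + 1) * (ε / (C * l⁻¹ + 1)) := by
        gcongr; exact le_self_add
    _ = ε := ENNReal.mul_div_cancel (by simp) (by finiteness)

end Covering

/-! ### The intermediate level set argument. -/

/-- Along a sequence of sets on which `v` satisfies a one-step reverse Hölder estimate, either the
averages stay below `2 * l`, or some set contains a large part of an intermediate level set. -/
lemma exists_lt_measure_inter_level {α : Type*} [MeasurableSpace α] {μ : Measure α}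
    [SFinite μ] {v : α → ℝ≥0∞} (hv : Measurable v) {S : ℕ → Set α} (hSm : ∀ j, MeasurableSet (S j))
    (hmono : ∀ j, μ (S (j + 1)) ≤ μ (S j)) {C η K l : ℝ≥0∞}
    (hstep : ∀ j, μ.withDensity v (S j) ≤ C * μ.withDensity v (S (j + 1)))
    (hη : ∀ j E, MeasurableSet E → μ (S j ∩ E) ≤ η * μ (S j) →
      μ.withDensity v (S j ∩ E) ≤ 2⁻¹ * μ.withDensity v (S (j + 1)))
    (hl0 : l ≠ 0) (hl : l ≠ ⊤) (hK : K ≠ ⊤) (hK0 : K ≠ 0) (hKC : 4 * C ≤ η * K) {J : ℕ}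
    (hleb : ∃ j ≥ J, μ.withDensity v (S j) ≤ 2 * l * μ (S j))
    (hJ : C ^ J * (2 * l * μ (S J)) < μ.withDensity v (S 0)) :
    ∃ j ≥ J, η / 2 * μ (S j) < μ (S j ∩ {z | l ≤ v z ∧ v z < K * l}) := by
  by_contra! hbad
  -- If the intermediate layer is thin, Chebyshev makes {v ≥ Kl} thin as well. Then {v ≥ l} carries
  -- mass at most l μ(S j), and so does its complement in S j: the bound 2l passes from j + 1 back
  -- to j.
  have claim : ∀ j ≥ J, μ.withDensity v (S (j + 1)) ≤ 2 * l * μ (S (j + 1)) →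
      μ.withDensity v (S j) ≤ 2 * l * μ (S j) := by
    intro j hj h
    have h' : μ.withDensity v (S (j + 1)) ≤ 2 * l * μ (S j) := h.trans (mul_le_mul_right (hmono j) _)
    have hmk : μ (S j ∩ {z | K * l ≤ v z}) ≤ η / 2 * μ (S j) := by
      have h1 := mul_meas_ge_le_lintegral (μ := μ.restrict (S j)) hv (K * l)
      rw [Measure.restrict_apply (measurableSet_le measurable_const hv), inter_comm,
        ← withDensity_apply _ (hSm j)] at h1
      have h2 := h1.trans ((hstep j).trans (mul_le_mul_right h' C))
      refine (ENNReal.mul_le_mul_iff_right (a := K * l) (by positivity) (by finiteness)).1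
        (h2.trans ?_)
      calc C * (2 * l * μ (S j)) = 4 * C * (l * μ (S j)) / 2 := by
            rw [ENNReal.eq_div_iff (by norm_num) (by norm_num)]; ring
        _ ≤ η * K * (l * μ (S j)) / 2 := by gcongr
        _ = K * l * (η / 2 * μ (S j)) := by simp only [div_eq_mul_inv]; ring
    have hmeas : MeasurableSet {z | l ≤ v z} := measurableSet_le measurable_const hv
    have hsmall : μ (S j ∩ {z | l ≤ v z}) ≤ η * μ (S j) := by
      calc μ (S j ∩ {z | l ≤ v z}) ≤ μ (S j ∩ {z | l ≤ v z ∧ v z < K * l} ∪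
            S j ∩ {z | K * l ≤ v z}) := by
            refine measure_mono fun z hz => ?_
            rcases lt_or_ge (v z) (K * l) with h3 | h3
            · exact Or.inl ⟨hz.1, hz.2, h3⟩
            · exact Or.inr ⟨hz.1, h3⟩
        _ ≤ η / 2 * μ (S j) + η / 2 * μ (S j) :=
            (measure_union_le _ _).trans (add_le_add (hbad j hj) hmk)
        _ = η * μ (S j) := by rw [← add_mul, ENNReal.add_halves]
    have hlow : μ.withDensity v (S j \ {z | l ≤ v z}) ≤ l * μ (S j) := by
      rw [withDensity_apply']
      calc ∫⁻ z in S j \ {z | l ≤ v z}, v z ∂μ ≤ ∫⁻ z in S j \ {z | l ≤ v z}, l ∂μ :=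
            setLIntegral_mono' ((hSm j).diff hmeas) fun z hz => (not_le.1 hz.2).le
        _ ≤ l * μ (S j) := by
            rw [setLIntegral_const]; gcongr; exact sdiff_subset
    rw [← measure_inter_add_sdiff (S j) hmeas]
    calc _ ≤ 2⁻¹ * (2 * l * μ (S j)) + l * μ (S j) :=
          add_le_add ((hη j _ hmeas hsmall).trans (by gcongr)) hlow
      _ = 2 * l * μ (S j) := by
          rw [mul_assoc 2, ← mul_assoc, ENNReal.inv_mul_cancel (by norm_num) (by norm_num), one_mul,
            two_mul]
  obtain ⟨j₁, hj₁, hle⟩ := hleb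
  have hdown : μ.withDensity v (S J) ≤ 2 * l * μ (S J) := by
    induction j₁, hj₁ using Nat.le_induction with
    | base => exact hle
    | succ j hj ih => exact ih (claim j hj hle)
  have hup : ∀ m, μ.withDensity v (S 0) ≤ C ^ m * μ.withDensity v (S m) := by
    intro m
    induction m with
    | zero => simp
    | succ m ih =>
      refine ih.trans ?_
      rw [pow_succ, mul_assoc]
      gcongr
      exact hstep m
  exact absurd ((hup J).trans (by gcongr)) (not_le.2 hJ)

/-! ### Mass estimates for past boxes and decay of sublevel sets. -/

section Decay

variable {n : ℕ} {p γ : ℝ} {ν : Measure ((Fin n → ℝ) × ℝ)} {c : ℝ≥0∞}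

lemma exists_pastBox_estimates (hγ0 : 0 < γ) (hγ1 : γ < 1) (hp : 0 < p) (hc : 1 ≤ c) (hc' : c ≠ ⊤)
    (hd : ∀ (x : Fin n → ℝ) (t L : ℝ), 0 < L →
      ν (lowerPart p γ x t L) ≤ c * ν (halfUpperPart p γ x t L))
    (hA : ∀ ε : ℝ≥0∞, ε ≠ 0 → ∃ η : ℝ≥0∞, η ≠ 0 ∧ η ≠ ⊤ ∧ ∀ (x : Fin n → ℝ) (t L : ℝ), 0 < L →
      ∀ E, MeasurableSet E →
        volume (lowerPart p 0 x t L ∩ E) ≤ η * volume (lowerPart p 0 x t L) →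
        ν (lowerPart p 0 x t L ∩ E) ≤ ε * ν (upperPart p 0 x t L)) :
    ∃ (A : ℝ) (C η : ℝ≥0∞), 2 ≤ A ∧ 1 ≤ C ∧ C ≠ ⊤ ∧ η ≠ 0 ∧ η ≠ ⊤ ∧
      ∀ (z : (Fin n → ℝ) × ℝ) (ℓ : ℝ), 0 < ℓ →
        ν (pastBox p ((1 - γ) / 2) A z ℓ) ≤ C * ν (pastBox p ((1 - γ) / 2) A z (ℓ / 2)) ∧
        ∀ E, MeasurableSet E →
          volume (pastBox p ((1 - γ) / 2) A z ℓ ∩ E) ≤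
            η * volume (pastBox p ((1 - γ) / 2) A z ℓ) →
          ν (pastBox p ((1 - γ) / 2) A z ℓ ∩ E) ≤
            2⁻¹ * ν (pastBox p ((1 - γ) / 2) A z (ℓ / 2)) := by
  set β : ℝ := (1 - γ) / 2 with hβ
  have hβ0 : 0 < β := by rw [hβ]; linarith
  have h2 : (1 : ℝ) < 2 ^ p := Real.one_lt_rpow (by norm_num) hp
  have hσ : 0 < β * (2 ^ p - 1) := mul_pos hβ0 (by linarith)
  obtain ⟨k, hk⟩ := exists_nat_ge ((1 + γ) * 2 ^ p / (β * (2 ^ p - 1)))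
  rw [div_le_iff₀ hσ] at hk
  -- At least 2, so that chains of boxes of size ℓ/2 have spatial reach ℓ/2.
  set M := max 2 k with hM
  have hkM : (1 + γ) * 2 ^ p ≤ M * (β * (2 ^ p - 1)) := hk.trans (by
    gcongr; exact_mod_cast le_max_right _ _)
  have hM2 : (2 : ℝ) ≤ M := by exact_mod_cast le_max_left 2 k
  -- Chosen so that the lag A(ℓ^p - (ℓ/2)^p) between consecutive past boxes equals 2ℓ^p plus `M`
  -- steps at size ℓ/2.
  set A : ℝ := (2 * 2 ^ p + M * ((1 + γ) * 2 ^ p)) / (2 ^ p - 1) with hAdef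
  have hA0 : 0 < A := div_pos (by positivity) (by linarith)
  have hAe : A * (2 ^ p - 1) = 2 * 2 ^ p + M * ((1 + γ) * 2 ^ p) :=
    div_mul_cancel₀ _ (by linarith)
  have hA2 : 2 ≤ A := by
    rw [hAdef, le_div_iff₀ (by linarith)]
    have : 0 ≤ M * ((1 + γ) * 2 ^ p) := by positivity
    linarith
  -- The time radius 2 contains the past box and also the unlagged upper part that starts where the
  -- box ends.
  obtain ⟨C, hC, hCF⟩ := exists_measure_le_timeBox_of_lag hγ0 hγ1 hp hc hc' hd (ε := 1 / 2)
    (a := 1 / 2) (a' := 0) (b := 2) A (by norm_num) hkM (by linarith)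
  have hC1 : max C 1 ≠ ⊤ := by simp [hC]
  obtain ⟨η, hη0, hη, hAη⟩ := hA (2⁻¹ / max C 1) (by simp [hC])
  have key : ∀ (z : (Fin n → ℝ) × ℝ) (ℓ : ℝ), 0 < ℓ → ∀ E : Set ((Fin n → ℝ) × ℝ),
      (∀ y ∈ E, (∀ i, |y.1 i - z.1 i| ≤ ℓ / 2) ∧ |y.2 - (z.2 - A * ℓ ^ p)| ≤ 2 * ℓ ^ p) →
      ν E ≤ max C 1 * ν (pastBox p β A z (ℓ / 2)) := by
    intro z ℓ hℓ E hE
    have hℓp : 0 < ℓ ^ p := Real.rpow_pos_of_pos hℓ p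
    have e1 : (ℓ / 2) ^ p = ℓ ^ p / 2 ^ p := Real.div_rpow hℓ.le (by norm_num) p
    have e2 : (1 / 2 * ℓ) = ℓ / 2 := by ring
    have := hCF z.1 (z.2 - A * ℓ ^ p) ℓ hℓ E (fun y hy => ⟨fun i => by
      rw [e2]; exact (hE y hy).1 i, (hE y hy).2⟩) z.1 (z.2 - A * (ℓ / 2) ^ p) (by simp) ?_ ?_
    · rw [e2] at this
      exact this.trans (mul_le_mul_left (le_max_left _ _) _)
    · rw [e2, e1]
      apply le_of_eq
      field_simp
      linear_combination (-ℓ ^ p) * hAe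
    · have : 0 < A * (ℓ / 2) ^ p := by positivity
      linarith
  refine ⟨A, max C 1, η, hA2, le_max_right _ _, hC1, hη0, hη, fun z ℓ hℓ => ⟨?_, ?_⟩⟩
  · have hℓp : 0 < ℓ ^ p := Real.rpow_pos_of_pos hℓ p
    refine key z ℓ hℓ _ fun y ⟨hy1, hy2, hy3⟩ => ⟨hy1, ?_⟩
    rw [abs_le]; constructor <;> nlinarith
  · intro E hE hvol
    have hℓp : 0 < ℓ ^ p := Real.rpow_pos_of_pos hℓ p
    set S := pastBox p β A z ℓ with hS
    -- The final time of the past box, which therefore lies at the top of R⁻, adjacent to R⁺.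
    set t : ℝ := z.2 - A * ℓ ^ p + β * ℓ ^ p with ht
    have hSR : S ⊆ lowerPart p 0 z.1 t ℓ := by
      rintro y ⟨hy1, hy2, hy3⟩
      refine ⟨hy1, ?_, ?_⟩
      · rw [ht]; nlinarith
      · rw [ht]; linarith
    have h1 : lowerPart p 0 z.1 t ℓ ∩ (S ∩ E) = S ∩ E :=
      inter_eq_self_of_subset_right (inter_subset_left.trans hSR)
    have h3 := hAη z.1 t ℓ hℓ (S ∩ E) ((measurableSet_pastBox _ _ _ _ _).inter hE) (by
      rw [h1]; exact hvol.trans (by gcongr))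
    rw [h1] at h3
    refine h3.trans ?_
    have h4 : ν (upperPart p 0 z.1 t ℓ) ≤ max C 1 * ν (pastBox p β A z (ℓ / 2)) := by
      refine key z ℓ hℓ _ fun y ⟨hy1, hy2, hy3⟩ => ⟨hy1, ?_⟩
      rw [abs_le]; constructor <;> nlinarith
    calc 2⁻¹ / max C 1 * ν (upperPart p 0 z.1 t ℓ)
        ≤ 2⁻¹ / max C 1 * (max C 1 * ν (pastBox p β A z (ℓ / 2))) := by gcongr
      _ = 2⁻¹ * ν (pastBox p β A z (ℓ / 2)) := by
        rw [← mul_assoc, ENNReal.div_mul_cancel (by simp) hC1]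

/-- Crossing a distance of order L with boxes of size εL takes about 1/ε steps of duration
comparable to (εL)^p, a total time of order ε^(p-1) L^p. Since p > 1, this fits into the gap 2γL^p
between R⁻(γ) and R⁺(γ). -/
lemma exists_small_scale (hp : 1 < p) (hγ0 : 0 < γ) (α B : ℝ) (k : ℕ) :
    ∃ (ε : ℝ) (M : ℕ), 0 < ε ∧ ε ≤ 1 ∧ k ≤ M ∧ M * ε = 3 ∧ (M * α + B) * ε ^ p ≤ 2 * γ := by
  have h1 : Filter.Tendsto (fun M : ℕ => 3 ^ p * (α * (M : ℝ) ^ (-(p - 1)) + B * (M : ℝ) ^ (-p)))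
      Filter.atTop (nhds 0) := by
    have t1 := (tendsto_rpow_neg_atTop (y := p - 1) (by linarith)).comp tendsto_natCast_atTop_atTop
    have t2 := (tendsto_rpow_neg_atTop (y := p) (by linarith)).comp tendsto_natCast_atTop_atTop
    simpa using ((t1.const_mul α).add (t2.const_mul B)).const_mul (3 ^ p)
  obtain ⟨M, hM1, hM2⟩ := ((h1.eventually_le_const (show 0 < 2 * γ by linarith)).and
    (Filter.eventually_ge_atTop (max 3 k))).exists
  have hM3 : (3 : ℝ) ≤ M := by exact_mod_cast (le_max_left 3 k).trans hM2
  have hM0 : (0 : ℝ) < M := by linarith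
  refine ⟨3 / M, M, by positivity, by rwa [div_le_one hM0], (le_max_right 3 k).trans hM2,
    by field_simp, ?_⟩
  refine le_of_eq_of_le ?_ hM1
  rw [Real.div_rpow (by norm_num) hM0.le, Real.rpow_neg hM0.le, Real.rpow_neg hM0.le, Real.rpow_sub hM0,
    Real.rpow_one]
  field_simp

lemma exists_measure_lowerPart_le_pastBox (hγ0 : 0 < γ) (hγ1 : γ < 1) (hp : 1 < p) (hc : 1 ≤ c)
    (hc' : c ≠ ⊤)
    (hd : ∀ (x : Fin n → ℝ) (t L : ℝ), 0 < L →
      ν (lowerPart p γ x t L) ≤ c * ν (halfUpperPart p γ x t L)) {A : ℝ} (hA : 0 < A) :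
    ∃ (ε : ℝ) (C : ℝ≥0∞), 0 < ε ∧ ε ≤ 1 ∧ C ≠ ⊤ ∧ ∀ (x : Fin n → ℝ) (t L : ℝ), 0 < L →
      ∀ z : (Fin n → ℝ) × ℝ, (∀ i, |z.1 i - x i| ≤ L) →
        t + γ * L ^ p - (A + (1 - γ) / 2) * (ε * L) ^ p ≤ z.2 → z.2 ≤ t + L ^ p →
        ν (lowerPart p γ x t L) ≤ C * ν (pastBox p ((1 - γ) / 2) A z (ε * L)) := by
  have hp0 : 0 < p := by linarith
  have hβ0 : 0 < (1 - γ) / 2 := by linarith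
  have h2 : (1 : ℝ) < 2 ^ p := Real.one_lt_rpow (by norm_num) hp0
  have hσ : 0 < (1 - γ) / 2 * (2 ^ p - 1) := mul_pos hβ0 (by linarith)
  obtain ⟨k, hk⟩ := exists_nat_ge ((1 + γ) * 2 ^ p / ((1 - γ) / 2 * (2 ^ p - 1)))
  rw [div_le_iff₀ hσ] at hk
  obtain ⟨ε, M, hε, hε1, hkM, hMε, hsmall⟩ := exists_small_scale hp hγ0 ((1 + γ) * 2 ^ p)
    (2 * A + (1 - γ) / 2) k
  have hkM' : (1 + γ) * 2 ^ p ≤ M * ((1 - γ) / 2 * (2 ^ p - 1)) := hk.trans (by gcongr)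
  obtain ⟨C, hC, hCF⟩ := exists_measure_le_timeBox_of_lag hγ0 hγ1 hp0 hc hc' hd (ε := ε)
    (a := 1 / 2) (a' := 1) (b := (1 - γ) / 2) 2 hε hkM' (by linarith)
  refine ⟨ε, C, hε, hε1, hC, fun x t L hL z hz hz1 hz2 => ?_⟩
  have hLp : 0 < L ^ p := Real.rpow_pos_of_pos hL p
  have hεp : 0 < ε ^ p := Real.rpow_pos_of_pos hε p
  have e3 : (ε * L) ^ p = ε ^ p * L ^ p := Real.mul_rpow hε.le hL.le
  refine hCF x (t - (1 + γ) / 2 * L ^ p) L hL (lowerPart p γ x t L) ?_ z.1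
    (z.2 - A * (ε * L) ^ p) (fun i => by rw [one_mul]; exact hz i) ?_ ?_
  · rintro y ⟨hy1, hy2, hy3⟩
    refine ⟨fun i => (hy1 i).trans_eq (by ring), ?_⟩
    rw [abs_le]; constructor <;> linarith
  · have := mul_le_mul_of_nonneg_right hsmall hLp.le
    rw [e3] at hz1 ⊢
    linarith
  · have : 0 < A * (ε * L) ^ p := by positivity
    nlinarith

end Decay

lemma volume_lowerPart {n : ℕ} (p γ : ℝ) (x : Fin n → ℝ) (t : ℝ) {L : ℝ} (hL : 0 ≤ L) :
    volume (lowerPart p γ x t L) = ENNReal.ofReal (L ^ n * ((1 - γ) * L ^ p)) := by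
  rw [lowerPart, volume_spatialCube_prod _ hL]
  congr 1; ring

lemma volume_upperPart {n : ℕ} (p γ : ℝ) (x : Fin n → ℝ) (t : ℝ) {L : ℝ} (hL : 0 ≤ L) :
    volume (upperPart p γ x t L) = ENNReal.ofReal (L ^ n * ((1 - γ) * L ^ p)) := by
  rw [upperPart, volume_spatialCube_prod _ hL]
  congr 1; ring

lemma ENNReal.le_div_mul_of_le_mul_add {a b c D : ℝ≥0∞} (hD : D ≠ ⊤) (h : b = a + c)
    (hac : a ≤ D * c) : a ≤ D / (1 + D) * b := by
  rw [mul_comm, ← mul_div_assoc, ENNReal.le_div_iff_mul_le (Or.inl (by simp))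
    (Or.inl (by finiteness)), h]
  calc a * (1 + D) = a + a * D := by ring
    _ ≤ D * c + a * D := by gcongr
    _ = (a + c) * D := by ring

section Decay

variable {n : ℕ} {p γ : ℝ} {c : ℝ≥0∞}

/-- Geometric decay of the volume of the sublevel sets of `v` in the upper part. -/
lemma exists_volume_sublevel_le (hγ0 : 0 < γ) (hγ1 : γ < 1) (hp : 1 < p) (hc : 1 ≤ c) (hc' : c ≠ ⊤)
    {v : (Fin n → ℝ) × ℝ → ℝ≥0∞} (hv : Measurable v) [IsLocallyFiniteMeasure (volume.withDensity v)]
    (hd : ∀ (x : Fin n → ℝ) (t L : ℝ), 0 < L → volume.withDensity v (lowerPart p γ x t L) ≤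
      c * volume.withDensity v (halfUpperPart p γ x t L))
    (hA : ∀ ε : ℝ≥0∞, ε ≠ 0 → ∃ η : ℝ≥0∞, η ≠ 0 ∧ η ≠ ⊤ ∧ ∀ (x : Fin n → ℝ) (t L : ℝ), 0 < L →
      ∀ E, MeasurableSet E →
        volume (lowerPart p 0 x t L ∩ E) ≤ η * volume (lowerPart p 0 x t L) →
        volume.withDensity v (lowerPart p 0 x t L ∩ E) ≤
          ε * volume.withDensity v (upperPart p 0 x t L)) :
    ∃ κ K θ C : ℝ≥0∞, κ ≠ 0 ∧ κ ≠ ⊤ ∧ 1 ≤ K ∧ K ≠ ⊤ ∧ θ < 1 ∧ C ≠ ⊤ ∧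
      ∀ (x : Fin n → ℝ) (t L : ℝ), 0 < L → ∀ W : ℝ≥0∞, W ≠ 0 → W ≠ ⊤ →
        W * volume (lowerPart p γ x t L) ≤ volume.withDensity v (lowerPart p γ x t L) → ∀ m : ℕ,
        volume (upperPart p γ x t L ∩ {z | v z < κ * W / K ^ m}) ≤
          C * θ ^ m * volume (upperPart p γ x t L) := by
  have hp0 : 0 < p := by linarith
  have hβ0 : 0 < (1 - γ) / 2 := by linarith
  obtain ⟨A, C₀, η, hA2, hC₀1, hC₀, hη0, hη, hest⟩ := exists_pastBox_estimates hγ0 hγ1 hp0 hc hc' hd hA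
  have hA0 : 0 < A := by linarith
  obtain ⟨ε, C₁, hε, hε1, hC₁, hinit⟩ := exists_measure_lowerPart_le_pastBox hγ0 hγ1 hp hc hc' hd hA0
  obtain ⟨C₂, hC₂, hcov⟩ := exists_volume_le_of_pastBox n hp0 hβ0 hA0.le
  set β : ℝ := (1 - γ) / 2 with hβ
  -- The first term absorbs the doubling loss C₀^(m+1); the second makes Chebyshev's inequality
  -- effective at height Kl.
  set K : ℝ≥0∞ := C₀ + 4 * C₀ / η with hK
  have hKtop : K ≠ ⊤ := by
    have : 4 * C₀ / η ≠ ⊤ := ENNReal.div_ne_top (by finiteness) hη0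
    finiteness
  have hK1 : 1 ≤ K := hC₀1.trans le_self_add
  have hK0 : K ≠ 0 := (zero_lt_one.trans_le hK1).ne'
  have hKC : 4 * C₀ ≤ η * K := by
    rw [hK, mul_add, ENNReal.mul_div_cancel hη0 hη]; exact le_add_self
  set D : ℝ≥0∞ := C₂ * (η / 2)⁻¹ with hD
  have hDtop : D ≠ ⊤ := ENNReal.mul_ne_top hC₂ (ENNReal.inv_ne_top.2 (by simp [hη0]))
  set κ : ℝ≥0∞ := (4 * (C₁ + 1))⁻¹ with hκ
  have hκ0 : κ ≠ 0 := ENNReal.inv_ne_zero.2 (by finiteness)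
  have hκtop : κ ≠ ⊤ := ENNReal.inv_ne_top.2 (by simp)
  -- The ratio comes from |E (m+1)| ≤ D |E m \ E (m+1)|, the last constant from comparing B 0 with
  -- R⁺(γ).
  refine ⟨κ, K, D / (1 + D), ENNReal.ofReal (2 ^ n * (1 + (A + β) / (1 - γ))), hκ0, hκtop, hK1,
    hKtop, ?_, ENNReal.ofReal_ne_top, fun x t L hL W hW0 hW hWle m => ?_⟩
  · rw [ENNReal.div_lt_iff (Or.inl (by simp)) (Or.inl (by finiteness)), one_mul, add_comm]
    exact ENNReal.lt_add_right hDtop one_ne_zero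
  have hLp : 0 < L ^ p := Real.rpow_pos_of_pos hL p
  set ℓ₀ := ε * L with hℓ₀
  have hℓ₀0 : 0 < ℓ₀ := by positivity
  have hℓ₀p : 0 < ℓ₀ ^ p := Real.rpow_pos_of_pos hℓ₀0 p
  have hℓ₀L : ℓ₀ ≤ L := by rw [hℓ₀]; nlinarith
  -- Neighborhoods of R⁺(γ), enlarged in space and into the past, with margins halved at each step.
  -- Past boxes of points of B (m+1) stay in B m from scale index m + 1 on.
  set B : ℕ → Set ((Fin n → ℝ) × ℝ) := fun m => spatialCube x (L + ℓ₀ / 2 ^ m) ×ˢ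
    Ioo (t + γ * L ^ p - (A + β) * ℓ₀ ^ p / 2 ^ m) (t + L ^ p) with hB
  have hBm : ∀ m, MeasurableSet (B m) := fun m =>
    (measurableSet_spatialCube _ _).prod measurableSet_Ioo
  have hhalf : ∀ j : ℕ, ℓ₀ / 2 ^ j / 2 = ℓ₀ / 2 ^ (j + 1) := fun j => by
    rw [pow_succ, div_div]
  have hℓj : ∀ j : ℕ, 0 < ℓ₀ / 2 ^ j := fun j => by positivity
  have hanti : ∀ {i j : ℕ}, i ≤ j → ℓ₀ / 2 ^ j ≤ ℓ₀ / 2 ^ i := fun h =>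
    div_le_div_of_nonneg_left hℓ₀0.le (by positivity) (pow_le_pow_right₀ (by norm_num) h)
  have hscale : ∀ m : ℕ, (A + β) * ℓ₀ ^ p / 2 ^ m = 2 * ((A + β) * ℓ₀ ^ p / 2 ^ (m + 1)) :=
    fun m => by rw [pow_succ]; field_simp
  have hscale0 : ∀ m : ℕ, 0 < (A + β) * ℓ₀ ^ p / 2 ^ m := fun m => by positivity
  have hBz : ∀ m, ∀ z ∈ B (m + 1), ∀ j ≥ m + 1, pastBox p β A z (ℓ₀ / 2 ^ j) ⊆ B m := by
    rintro m z ⟨hz1, hz2, hz3⟩ j hj y ⟨hy1, hy2, hy3⟩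
    have hjp : 0 < (ℓ₀ / 2 ^ j) ^ p := Real.rpow_pos_of_pos (hℓj j) p
    refine ⟨fun i => ?_, ?_, ?_⟩
    · have h1 := abs_le.1 (hz1 i)
      have h2 := abs_le.1 (hy1 i)
      have h3 := hanti hj
      have h4 := hhalf m
      rw [abs_le]; constructor <;> linarith
    · have h1 : (ℓ₀ / 2 ^ j) ^ p ≤ ℓ₀ ^ p / 2 ^ (m + 1) := by
        rw [Real.div_rpow hℓ₀0.le (by positivity)]
        have h2 : (2 : ℝ) ^ (m + 1) ≤ 2 ^ j := pow_le_pow_right₀ (by norm_num) hj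
        have h3 : (2 : ℝ) ^ j ≤ (2 ^ j) ^ p :=
          Real.self_le_rpow_of_one_le (one_le_pow₀ (by norm_num)) hp.le
        exact div_le_div_of_nonneg_left hℓ₀p.le (by positivity) (h2.trans h3)
      have h4 := mul_le_mul_of_nonneg_left h1 (by positivity : 0 ≤ A + β)
      rw [← mul_div_assoc] at h4
      have := hscale m
      linarith
    · have h1 : β * (ℓ₀ / 2 ^ j) ^ p ≤ A * (ℓ₀ / 2 ^ j) ^ p := by
        gcongr
        rw [hβ]; linarith
      linarith
  have hBsub : ∀ m, B (m + 1) ⊆ B m := by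
    rintro m z ⟨hz1, hz2, hz3⟩
    refine ⟨fun i => (hz1 i).trans ?_, ?_, hz3⟩
    · have := hanti (Nat.le_add_right m 1)
      linarith
    · have h1 := hscale m
      have h2 := hscale0 (m + 1)
      linarith
  set E : ℕ → Set ((Fin n → ℝ) × ℝ) := fun m => B m ∩ {z | v z < κ * W / K ^ m} with hE
  have hEm : ∀ m, MeasurableSet (E m) := fun m =>
    (hBm m).inter (measurableSet_lt hv measurable_const)
  have hEsub : ∀ m, E (m + 1) ⊆ E m := by
    intro m z hz
    have h : κ * W / K ^ (m + 1) ≤ κ * W / K ^ m :=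
      ENNReal.div_le_div_left (pow_le_pow_right₀ hK1 m.le_succ) _
    exact ⟨hBsub m hz.1, lt_of_lt_of_le hz.2 h⟩
  have hstepE : ∀ m, volume (E (m + 1)) ≤ D * volume (E m \ E (m + 1)) := by
    intro m
    set l := κ * W / K ^ (m + 1) with hl
    have hl0 : l ≠ 0 := ENNReal.div_ne_zero.2 ⟨by positivity, by finiteness⟩
    have hltop : l ≠ ⊤ := ENNReal.div_ne_top (by finiteness) (by positivity)
    have hKl' : K ^ (m + 1) * l = κ * W := ENNReal.mul_div_cancel (by positivity) (by finiteness)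
    have hKl : K * l = κ * W / K ^ m := by
      rw [ENNReal.eq_div_iff (by positivity) (by finiteness), ← mul_assoc, ← pow_succ, hKl']
    have hae := ae_exists_withDensity_pastBox_le hp0 hβ0 hA0.le hv hl0 hltop hℓ₀0
    rw [ae_iff] at hae
    set N := {z | ¬(v z < l → ∀ J : ℕ, ∃ j ≥ J,
      volume.withDensity v (pastBox p β A z (ℓ₀ / 2 ^ j)) ≤
      2 * l * volume (pastBox p β A z (ℓ₀ / 2 ^ j)))} with hN
    set G := {z | l ≤ v z ∧ v z < K * l} with hG
    have hmain := hcov (volume.restrict G) (E (m + 1) \ N) (B m) (η / 2)⁻¹ ℓ₀ (by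
      intro z hz
      have hzl : v z < l := hz.1.2
      have hzN : ∀ J : ℕ, ∃ j ≥ J, volume.withDensity v (pastBox p β A z (ℓ₀ / 2 ^ j)) ≤
          2 * l * volume (pastBox p β A z (ℓ₀ / 2 ^ j)) := by
        have := hz.2
        rw [hN, mem_ofPred_eq, not_not] at this
        exact this hzl
      have hvolS : ∀ j, volume (pastBox p β A z (ℓ₀ / 2 ^ j)) ≤ volume (lowerPart p γ x t L) := by
        intro j
        refine (volume_pastBox_mono hp0.le hβ0.le z (hℓj j).le
          ((div_le_self hℓ₀0.le (one_le_pow₀ (by norm_num))).trans hℓ₀L)).trans_eq ?_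
        rw [volume_pastBox _ _ _ _ hL.le, volume_lowerPart _ _ _ _ hL.le, hβ]
        congr 1; ring
      obtain ⟨j, hj, hlt⟩ := exists_lt_measure_inter_level hv
        (S := fun j => pastBox p β A z (ℓ₀ / 2 ^ j)) (fun j => measurableSet_pastBox _ _ _ _ _)
        (fun j => volume_pastBox_mono hp0.le hβ0.le z (hℓj _).le (by
          rw [← hhalf]; exact half_le_self (hℓj j).le))
        (fun j => by have := (hest z _ (hℓj j)).1; rwa [hhalf] at this)
        (fun j => by have := (hest z _ (hℓj j)).2; rwa [hhalf] at this)
        hl0 hltop hKtop hK0 hKC (J := m + 1) (hzN _) (by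
          -- Otherwise the first past box has too little mass: K^(m+1) l = κW and the choice of κ
          -- would give W|R⁻(γ)| ≤ W|R⁻(γ)|/2.
          by_contra! hcon
          rw [pow_zero, div_one] at hcon
          have hz0 : z ∈ B 0 := by
            have : ∀ k, B k ⊆ B 0 := fun k => by
              induction k with
              | zero => exact subset_rfl
              | succ k ih => exact (hBsub k).trans ih
            exact this _ hz.1.1
          obtain ⟨hz1, hz2, hz3⟩ := hz0
          rw [pow_zero, div_one] at hz1 hz2
          have h1 := hinit x t L hL z (fun i => (hz1 i).trans (by linarith)) hz2.le hz3.le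
          set V := volume (lowerPart p γ x t L) with hV
          have hVtop : V ≠ ⊤ := by rw [hV, volume_lowerPart _ _ _ _ hL.le]; finiteness
          have hV0 : V ≠ 0 := by
            rw [hV, volume_lowerPart _ _ _ _ hL.le, ENNReal.ofReal_ne_zero_iff]
            have : 0 < 1 - γ := by linarith
            positivity
          refine absurd (hWle.trans (h1.trans (mul_le_mul_right hcon _)))
            (not_le.2 (lt_of_le_of_lt ?_ (ENNReal.half_lt_self (mul_ne_zero hW0 hV0)
              (ENNReal.mul_ne_top hW hVtop))))
          calc C₁ * (C₀ ^ (m + 1) * (2 * l * volume (pastBox p β A z (ℓ₀ / 2 ^ (m + 1)))))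
              ≤ (C₁ + 1) * (K ^ (m + 1) * (2 * l * V)) := by
                gcongr
                · exact le_self_add
                · exact le_self_add
                · exact hvolS _
            _ = 2 * (C₁ + 1) * (K ^ (m + 1) * l) * V := by ring
            _ = W * V / 2 := by
                rw [hKl', hκ, ENNReal.eq_div_iff (by norm_num) (by norm_num)]
                calc 2 * (2 * (C₁ + 1) * ((4 * (C₁ + 1))⁻¹ * W) * V)
                    = (4 * (C₁ + 1)) * (4 * (C₁ + 1))⁻¹ * (W * V) := by ring
                  _ = W * V := by
                    rw [ENNReal.mul_inv_cancel (by simp) (by finiteness), one_mul])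
      refine ⟨ℓ₀ / 2 ^ j, hℓj j, div_le_self hℓ₀0.le (one_le_pow₀ (by norm_num)), ?_, ?_⟩
      · exact hBz m z hz.1.1 _ hj
      · rw [Measure.restrict_apply (measurableSet_pastBox _ _ _ _ _), mul_comm, ← div_eq_mul_inv,
          ENNReal.le_div_iff_mul_le (Or.inl (by simp [hη0])) (Or.inl (by finiteness)), mul_comm]
        exact hlt.le)
    rw [measure_sdiff_null hae] at hmain
    refine hmain.trans ?_
    rw [hD, mul_assoc, Measure.restrict_apply (hBm m)]
    gcongr
    rintro z ⟨hz1, hz2, hz3⟩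
    refine ⟨⟨hz1, ?_⟩, fun h => not_lt.2 hz2 h.2⟩
    rw [hKl] at hz3; exact hz3
  have hdecay : ∀ m, volume (E m) ≤ (D / (1 + D)) ^ m * volume (B 0) := by
    intro m
    induction m with
    | zero => rw [pow_zero, one_mul]; exact measure_mono inter_subset_left
    | succ m ih =>
      have h1 : volume (E m) = volume (E (m + 1)) + volume (E m \ E (m + 1)) := by
        rw [← measure_inter_add_sdiff (E m) (hEm (m + 1)), inter_eq_self_of_subset_right (hEsub m)]
      refine (ENNReal.le_div_mul_of_le_mul_add hDtop h1 (hstepE m)).trans ?_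
      rw [pow_succ', mul_assoc]
      gcongr
  have hB0 : volume (B 0) ≤ ENNReal.ofReal (2 ^ n * (1 + (A + β) / (1 - γ))) *
      volume (upperPart p γ x t L) := by
    have hγ : 0 < 1 - γ := by linarith
    rw [hB, volume_spatialCube_prod _ (by positivity), volume_upperPart _ _ _ _ hL.le,
      ← ENNReal.ofReal_mul (by positivity)]
    apply ENNReal.ofReal_le_ofReal
    have h1 : ℓ₀ ^ p ≤ L ^ p := Real.rpow_le_rpow hℓ₀0.le hℓ₀L hp0.le
    calc (L + ℓ₀ / 2 ^ 0) ^ n * (t + L ^ p - (t + γ * L ^ p - (A + β) * ℓ₀ ^ p / 2 ^ 0))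
        = (L + ℓ₀) ^ n * ((1 - γ) * L ^ p + (A + β) * ℓ₀ ^ p) := by
          rw [pow_zero, div_one, div_one]; ring
      _ ≤ (2 * L) ^ n * ((1 - γ) * L ^ p + (A + β) * L ^ p) := by
          gcongr; linarith
      _ = 2 ^ n * (1 + (A + β) / (1 - γ)) * (L ^ n * ((1 - γ) * L ^ p)) := by
          rw [mul_pow]; field_simp
  calc volume (upperPart p γ x t L ∩ {z | v z < κ * W / K ^ m}) ≤ volume (E m) := by
        refine measure_mono (inter_subset_inter_left _ ?_)
        rintro z ⟨hz1, hz2, hz3⟩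
        have h1 : 0 < (A + β) * ℓ₀ ^ p / 2 ^ m := by positivity
        have h2 : 0 < ℓ₀ / 2 ^ m := by positivity
        exact ⟨fun i => (hz1 i).trans (by linarith), by linarith, hz3⟩
    _ ≤ _ := hdecay m
    _ ≤ _ := by
      rw [mul_comm _ ((D / (1 + D)) ^ m), mul_assoc]
      gcongr

end Decay

/-! ### From geometric decay to a negative power. -/

lemma ENNReal.div_pow_rpow_neg {a b : ℝ≥0∞} (hb0 : b ≠ 0) (hb : b ≠ ⊤) {δ : ℝ} (hδ : 0 < δ)
    (m : ℕ) : (a / b ^ m) ^ (-δ) = a ^ (-δ) * (b ^ δ) ^ m := by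
  have h1 : (b ^ m) ^ δ ≠ 0 := by simp [hb0, hb, ENNReal.rpow_eq_zero_iff]
  have h2 : (b ^ m) ^ δ ≠ ⊤ := ENNReal.rpow_ne_top_of_nonneg hδ.le (by finiteness)
  rw [ENNReal.rpow_neg, ENNReal.div_rpow_of_nonneg _ _ hδ.le, ENNReal.inv_div (Or.inl h2) (Or.inl h1),
    ENNReal.rpow_neg, ← ENNReal.rpow_natCast, ← ENNReal.rpow_natCast, ← ENNReal.rpow_mul,
    ← ENNReal.rpow_mul, mul_comm (m : ℝ), div_eq_mul_inv, mul_comm]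

/-- Integrability of a negative power from geometric decay of sublevel sets. -/
lemma setLIntegral_rpow_neg_le {α : Type*} [MeasurableSpace α] {μ : Measure α} {B : Set α}
    {v : α → ℝ≥0∞} (hv : Measurable v) {l K θ C : ℝ≥0∞} (hl : l ≠ ⊤)
    (hK1 : 1 ≤ K) (hK : K ≠ ⊤)
    (hdecay : ∀ m : ℕ, μ (B ∩ {z | v z < l / K ^ m}) ≤ C * θ ^ m * μ B) {δ : ℝ} (hδ : 0 < δ) :
    ∫⁻ z in B, v z ^ (-δ) ∂μ ≤
      l ^ (-δ) * ((1 + C * K ^ δ * (1 - K ^ δ * θ)⁻¹) * μ B) := by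
  have hK0 : K ≠ 0 := (zero_lt_one.trans_le hK1).ne'
  have hm : ∀ m : ℕ, MeasurableSet {z | v z < l / K ^ m} := fun m =>
    measurableSet_lt hv measurable_const
  have hpt : ∀ z, v z ^ (-δ) ≤ l ^ (-δ) + ∑' m : ℕ, {z | v z < l / K ^ m}.indicator
      (fun _ => (l / K ^ (m + 1)) ^ (-δ)) z := by
    intro z
    -- Below every level, for instance where v vanishes, all terms of the series are at least l^(-δ)
    -- > 0, so the bound is infinite.
    by_cases hall : ∀ m : ℕ, v z < l / K ^ m
    · have hbig : ∀ m : ℕ, l ^ (-δ) ≤ {z | v z < l / K ^ m}.indicator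
          (fun _ => (l / K ^ (m + 1)) ^ (-δ)) z := by
        intro m
        rw [indicator_of_mem (by exact hall m), ENNReal.div_pow_rpow_neg hK0 hK hδ]
        exact le_mul_of_one_le_right' (one_le_pow₀ (ENNReal.one_le_rpow hK1 hδ))
      have htop : ∑' m : ℕ, {z | v z < l / K ^ m}.indicator
          (fun _ => (l / K ^ (m + 1)) ^ (-δ)) z = ⊤ := by
        refine top_le_iff.1 (le_trans (ENNReal.tsum_const_eq_top_of_ne_zero ?_).ge
          (ENNReal.tsum_le_tsum hbig))
        rw [ENNReal.rpow_neg]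
        exact ENNReal.inv_ne_zero.2 (ENNReal.rpow_ne_top_of_nonneg hδ.le hl)
      rw [htop, add_top]; exact le_top
    · push Not at hall
      classical
      have hanti : ∀ {a b : ℝ≥0∞}, a ≤ b → b ^ (-δ) ≤ a ^ (-δ) := fun h => by
        rw [ENNReal.rpow_neg, ENNReal.rpow_neg]
        exact ENNReal.inv_le_inv.2 (ENNReal.rpow_le_rpow h hδ.le)
      have hspec := Nat.find_spec hall
      rcases hfind : Nat.find hall with _ | k
      · rw [hfind, pow_zero, div_one] at hspec
        exact (hanti hspec).trans le_self_add
      · rw [hfind] at hspec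
        have hlt : v z < l / K ^ k := not_le.1 (Nat.find_min hall (by omega))
        refine (hanti hspec).trans (le_trans ?_ le_add_self)
        refine le_trans ?_ (ENNReal.le_tsum k)
        rw [indicator_of_mem (by exact hlt)]
  calc ∫⁻ z in B, v z ^ (-δ) ∂μ
      ≤ ∫⁻ z in B, (l ^ (-δ) + ∑' m : ℕ, {z | v z < l / K ^ m}.indicator
          (fun _ => (l / K ^ (m + 1)) ^ (-δ)) z) ∂μ := lintegral_mono hpt
    _ = l ^ (-δ) * μ B + ∑' m : ℕ, (l / K ^ (m + 1)) ^ (-δ) * μ (B ∩ {z | v z < l / K ^ m}) := by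
        rw [lintegral_add_left measurable_const, setLIntegral_const,
          lintegral_tsum fun m => (measurable_const.indicator (hm m)).aemeasurable]
        congr 2
        ext m
        rw [lintegral_indicator_const (hm m), Measure.restrict_apply (hm m), inter_comm]
    _ ≤ l ^ (-δ) * μ B + ∑' m : ℕ, l ^ (-δ) * (C * K ^ δ * μ B) * (K ^ δ * θ) ^ m := by
        refine add_le_add le_rfl (ENNReal.tsum_le_tsum fun m => ?_)
        rw [ENNReal.div_pow_rpow_neg hK0 hK hδ]
        calc l ^ (-δ) * (K ^ δ) ^ (m + 1) * μ (B ∩ {z | v z < l / K ^ m})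
            ≤ l ^ (-δ) * (K ^ δ) ^ (m + 1) * (C * θ ^ m * μ B) := by gcongr; exact hdecay m
          _ = l ^ (-δ) * (C * K ^ δ * μ B) * (K ^ δ * θ) ^ m := by rw [mul_pow]; ring
    _ = l ^ (-δ) * ((1 + C * K ^ δ * (1 - K ^ δ * θ)⁻¹) * μ B) := by
        rw [ENNReal.tsum_mul_left, ENNReal.tsum_geometric]; ring

lemma exists_rpow_mul_lt_one {K θ : ℝ≥0∞} (hK : K ≠ ⊤) (hθ : θ < 1) :
    ∃ δ : ℝ, 0 < δ ∧ K ^ δ * θ < 1 := by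
  have h := ENNReal.Tendsto.const_mul (a := K) (ENNReal.tendsto_pow_atTop_nhds_zero_of_lt_one hθ)
    (Or.inr hK)
  rw [mul_zero] at h
  obtain ⟨N, hN, hN1⟩ := ((h.eventually_lt_const zero_lt_one).and
    (Filter.eventually_ge_atTop 1)).exists
  have hN0 : (0 : ℝ) < N := by exact_mod_cast hN1
  -- The N-th root of K θ^N < 1.
  refine ⟨(N : ℝ)⁻¹, by positivity, ?_⟩
  have := ENNReal.rpow_lt_one hN (inv_pos.2 hN0)
  rwa [ENNReal.mul_rpow_of_nonneg _ _ (by positivity), ENNReal.pow_rpow_inv_natCast (by omega)] at this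

/-! ### Absolute continuity from reverse Hölder, and conclusion. -/

/-- A reverse Hölder inequality gives quantitative absolute continuity. -/
lemma setLIntegral_inter_le_of_reverseHolder {α : Type*} [MeasurableSpace α] {μ : Measure α}
    {v : α → ℝ≥0∞} (hv : Measurable v) {q : ℝ} (hq : 1 < q) {C η : ℝ≥0∞} {S T E : Set α}
    (hST : μ S = μ T) (hS0 : μ S ≠ 0) (hS : μ S ≠ ⊤)
    (hRH : (⨍⁻ z in S, v z ^ q ∂μ) ^ (1 / q) ≤ C * ⨍⁻ z in T, v z ∂μ)
    (hE : μ (S ∩ E) ≤ η * μ S) :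
    ∫⁻ z in S ∩ E, v z ∂μ ≤ C * η ^ (1 - 1 / q) * ∫⁻ z in T, v z ∂μ := by
  have hq0 : 0 < q := by linarith
  have hs : 0 < 1 - 1 / q := by
    rw [sub_pos, div_lt_one hq0]; exact hq
  have hconj := Real.HolderConjugate.conjExponent hq
  have hq' : 1 / Real.conjExponent q = 1 - 1 / q := by
    rw [Real.conjExponent]
    have : q - 1 ≠ 0 := by linarith
    field_simp
  have h1 := ENNReal.lintegral_mul_le_Lp_mul_Lq (μ.restrict (S ∩ E)) hconj hv.aemeasurable
    (g := fun _ => 1) aemeasurable_const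
  simp only [Pi.mul_apply, mul_one, ENNReal.one_rpow, lintegral_const, one_mul, hq',
    Measure.restrict_apply_univ] at h1
  rw [setLAverage_eq, setLAverage_eq, ← hST] at hRH
  calc ∫⁻ z in S ∩ E, v z ∂μ
      ≤ (∫⁻ z in S ∩ E, v z ^ q ∂μ) ^ (1 / q) * μ (S ∩ E) ^ (1 - 1 / q) := h1
    _ ≤ (∫⁻ z in S, v z ^ q ∂μ) ^ (1 / q) * (η * μ S) ^ (1 - 1 / q) := by
        gcongr
        exact inter_subset_left
    _ = ((∫⁻ z in S, v z ^ q ∂μ) / μ S) ^ (1 / q) * η ^ (1 - 1 / q) * μ S := by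
        rw [ENNReal.mul_rpow_of_nonneg _ _ hs.le, ENNReal.div_rpow_of_nonneg _ _ (by positivity)]
        have h2 : μ S ^ (1 / q) ≠ 0 := by simp [ENNReal.rpow_eq_zero_iff, hS0, hS]
        have h3 : μ S ^ (1 / q) ≠ ⊤ := ENNReal.rpow_ne_top_of_nonneg (by positivity) hS
        have h4 : μ S = μ S ^ (1 / q) * μ S ^ (1 - 1 / q) := by
          rw [← ENNReal.rpow_add _ _ hS0 hS, add_sub_cancel, ENNReal.rpow_one]
        have key : ∀ a b d e : ℝ≥0∞, a ≠ 0 → a ≠ ⊤ → d * (e * b) = d / a * e * (a * b) := by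
          intro a b d e ha0 ha
          calc d * (e * b) = d * (e * b) * (a⁻¹ * a) := by
                rw [ENNReal.inv_mul_cancel ha0 ha, mul_one]
            _ = d / a * e * (a * b) := by rw [div_eq_mul_inv]; ring
        rw [key _ _ _ _ h2 h3, ← h4]
    _ ≤ C * ((∫⁻ z in T, v z ∂μ) / μ S) * η ^ (1 - 1 / q) * μ S := by gcongr
    _ = C * η ^ (1 - 1 / q) * ((∫⁻ z in T, v z ∂μ) / μ S * μ S) := by ring
    _ = C * η ^ (1 - 1 / q) * ∫⁻ z in T, v z ∂μ := by rw [ENNReal.div_mul_cancel hS0 hS]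

lemma exists_mul_rpow_le {C ε : ℝ≥0∞} (hC : C ≠ ⊤) (hε : ε ≠ 0) {s : ℝ} (hs : 0 < s) :
    ∃ η : ℝ≥0∞, η ≠ 0 ∧ η ≠ ⊤ ∧ C * η ^ s ≤ ε := by
  -- The cutoff at 1 keeps the witness finite when ε = ∞; adding 1 covers C = 0.
  have h0 : min ε 1 / (C + 1) ≠ 0 := by simp [hε, hC]
  have ht : min ε 1 / (C + 1) ≠ ⊤ := ENNReal.div_ne_top (by simp) (by simp)
  refine ⟨(min ε 1 / (C + 1)) ^ s⁻¹, by simp [ENNReal.rpow_eq_zero_iff, h0, ht],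
    ENNReal.rpow_ne_top_of_nonneg (by positivity) ht, ?_⟩
  rw [ENNReal.rpow_inv_rpow hs.ne']
  calc C * (min ε 1 / (C + 1)) ≤ (C + 1) * (min ε 1 / (C + 1)) := by gcongr; exact le_self_add
    _ = min ε 1 := ENNReal.mul_div_cancel (by simp) (by finiteness)
    _ ≤ ε := min_le_left _ _

lemma muckenhouptConst_lt_top_of_decay {n : ℕ} {p γ : ℝ} (hγ1 : γ < 1)
    {w : (Fin n → ℝ) × ℝ → ℝ} {v : (Fin n → ℝ) × ℝ → ℝ≥0∞} (hv : Measurable v)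
    [IsLocallyFiniteMeasure (volume.withDensity v)] (hwv : (fun z => ENNReal.ofReal (w z)) =ᵐ[volume] v)
    {κ K θ C : ℝ≥0∞} (hκ0 : κ ≠ 0) (hκ : κ ≠ ⊤) (hK1 : 1 ≤ K) (hK : K ≠ ⊤) (hC : C ≠ ⊤)
    (hdecay : ∀ (x : Fin n → ℝ) (t L : ℝ), 0 < L → ∀ W : ℝ≥0∞, W ≠ 0 → W ≠ ⊤ →
        W * volume (lowerPart p γ x t L) ≤ volume.withDensity v (lowerPart p γ x t L) → ∀ m : ℕ,
        volume (upperPart p γ x t L ∩ {z | v z < κ * W / K ^ m}) ≤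
          C * θ ^ m * volume (upperPart p γ x t L))
    {δ : ℝ} (hδ : 0 < δ) (hKθ : K ^ δ * θ < 1) :
    muckenhouptConst p (1 + δ⁻¹) γ w < ⊤ := by
  set D : ℝ≥0∞ := 1 + C * K ^ δ * (1 - K ^ δ * θ)⁻¹ with hD
  have hDtop : D ≠ ⊤ := by
    have h1 : K ^ δ ≠ ⊤ := ENNReal.rpow_ne_top_of_nonneg hδ.le hK
    have h2 : (1 - K ^ δ * θ)⁻¹ ≠ ⊤ := ENNReal.inv_ne_top.2 (tsub_pos_of_lt hKθ).ne'
    finiteness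
  refine lt_of_le_of_lt (b := κ⁻¹ * D ^ δ⁻¹) ?_ ?_
  swap
  · exact ENNReal.mul_lt_top (ENNReal.inv_lt_top.2 (pos_iff_ne_zero.2 hκ0))
      (ENNReal.rpow_lt_top_of_nonneg (by positivity) hDtop)
  refine iSup_le fun x => iSup_le fun t => iSup_le fun L => iSup_le fun hL => ?_
  have hLp : 0 < L ^ p := Real.rpow_pos_of_pos hL p
  have hγ' : 0 < 1 - γ := by linarith
  have hVl0 : volume (lowerPart p γ x t L) ≠ 0 := by
    rw [volume_lowerPart _ _ _ _ hL.le, ENNReal.ofReal_ne_zero_iff]; positivity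
  have hVl : volume (lowerPart p γ x t L) ≠ ⊤ := by
    rw [volume_lowerPart _ _ _ _ hL.le]; finiteness
  have hVu0 : volume (upperPart p γ x t L) ≠ 0 := by
    rw [volume_upperPart _ _ _ _ hL.le, ENNReal.ofReal_ne_zero_iff]; positivity
  have hVu : volume (upperPart p γ x t L) ≠ ⊤ := by
    rw [volume_upperPart _ _ _ _ hL.le]; finiteness
  rw [add_sub_cancel_left, show 1 / (1 - (1 + δ⁻¹)) = -δ by
    rw [sub_add_cancel_left, one_div, inv_neg, inv_inv]]
  set W := ⨍⁻ z in lowerPart p γ x t L, ENNReal.ofReal (w z) ∂volume with hW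
  have hWV : W * volume (lowerPart p γ x t L) = volume.withDensity v (lowerPart p γ x t L) := by
    rw [hW, setLAverage_eq, ENNReal.div_mul_cancel hVl0 hVl, withDensity_apply']
    exact lintegral_congr_ae (ae_restrict_of_ae hwv)
  rcases eq_or_ne W 0 with hW0 | hW0
  · rw [hW0, zero_mul]; exact zero_le
  have hWtop : W ≠ ⊤ := by
    rw [hW, setLAverage_eq]
    refine ENNReal.div_ne_top ?_ hVl0
    have hbdd : Bornology.IsBounded (lowerPart p γ x t L) := by
      rw [lowerPart, spatialCube_eq_closedBall _ hL.le]
      exact Metric.isBounded_closedBall.prod (Metric.isBounded_Ioo _ _)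
    have h := (hbdd.measure_lt_top (μ := volume.withDensity v)).ne
    rw [withDensity_apply'] at h
    rwa [lintegral_congr_ae (ae_restrict_of_ae hwv)]
  have hint := setLIntegral_rpow_neg_le (B := upperPart p γ x t L) hv (l := κ * W) (by finiteness)
    hK1 hK (hdecay x t L hL W hW0 hWtop hWV.le) hδ
  have havg : ⨍⁻ z in upperPart p γ x t L, ENNReal.ofReal (w z) ^ (-δ) ∂volume ≤
      (κ * W) ^ (-δ) * D := by
    rw [setLAverage_eq, ENNReal.div_le_iff hVu0 hVu, mul_assoc]
    refine (lintegral_congr_ae (ae_restrict_of_ae ?_)).trans_le hint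
    filter_upwards [hwv] with z hz
    rw [hz]
  calc W * (⨍⁻ z in upperPart p γ x t L, ENNReal.ofReal (w z) ^ (-δ) ∂volume) ^ δ⁻¹
      ≤ W * ((κ * W) ^ (-δ) * D) ^ δ⁻¹ := by gcongr
    _ = W * ((κ * W)⁻¹ * D ^ δ⁻¹) := by
        rw [ENNReal.mul_rpow_of_nonneg _ _ (by positivity), ← ENNReal.rpow_mul, neg_mul,
          mul_inv_cancel₀ hδ.ne', ENNReal.rpow_neg_one]
    _ = W * W⁻¹ * (κ⁻¹ * D ^ δ⁻¹) := by
        rw [ENNReal.mul_inv (Or.inl hκ0) (Or.inl hκ)]; ring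
    _ = κ⁻¹ * D ^ δ⁻¹ := by rw [ENNReal.mul_inv_cancel hW0 hWtop, one_mul]

theorem mainTheorem3 (n : ℕ) (hn : 1 ≤ n) (p q γ : ℝ) (hp : 1 < p) (hq : 1 < q)
    (hγ0 : 0 < γ) (hγ1 : γ < 1) (w : (Fin n → ℝ) × ℝ → ℝ)
    (hRH : MemParabolicRH p q w) (hD : IsForwardDoubling p γ w) :
    ∃ r : ℝ, 1 < r ∧ MemParabolicMuckenhoupt p r γ w := by
  obtain ⟨hw, C, -, hC⟩ := hRH
  obtain ⟨c, -, hc⟩ := hD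
  have hmeas : AEMeasurable (fun z => ENNReal.ofReal (w z)) :=
    hw.locallyIntegrable.aestronglyMeasurable.aemeasurable.ennreal_ofReal
  -- A measurable modification makes the level sets measurable and changes none of the integrals.
  set v := hmeas.mk with hvdef
  have hv : Measurable v := hmeas.measurable_mk
  have hwv : (fun z => ENNReal.ofReal (w z)) =ᵐ[volume] v := hmeas.ae_eq_mk
  have hmass : ∀ E, weightMass w E = volume.withDensity v E := fun E => by
    rw [weightMass, withDensity_apply']
    exact lintegral_congr_ae (ae_restrict_of_ae hwv)
  have hlf : IsLocallyFiniteMeasure (volume.withDensity v) := by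
    refine ⟨fun z => ?_⟩
    obtain ⟨s, hs, hint⟩ := hw.locallyIntegrable z
    refine ⟨s, hs, ?_⟩
    rw [← hmass]
    exact hint.lintegral_lt_top
  obtain ⟨κ, K, θ, C', hκ0, hκ, hK1, hK, hθ, hC', hdecay⟩ := exists_volume_sublevel_le hγ0 hγ1 hp
    (c := max (ENNReal.ofReal c) 1) (le_max_right _ _) (by simp) hv
    (fun x t L hL => by
      rw [← hmass, ← hmass]
      exact (hc x t L hL).trans (mul_le_mul_left (le_max_left _ _) _))
    (fun ε hε => by
      obtain ⟨η, hη0, hη, hle⟩ := exists_mul_rpow_le (C := ENNReal.ofReal C) ENNReal.ofReal_ne_top hε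
        (s := 1 - 1 / q) (by rw [sub_pos, div_lt_one (by linarith)]; exact hq)
      refine ⟨η, hη0, hη, fun x t L hL E hE hvol => ?_⟩
      rw [withDensity_apply', withDensity_apply']
      refine (setLIntegral_inter_le_of_reverseHolder hv hq (T := upperPart p 0 x t L) ?_ ?_ ?_ ?_
        hvol).trans (mul_le_mul_left hle _)
      · rw [volume_lowerPart _ _ _ _ hL.le, volume_upperPart _ _ _ _ hL.le]
      · rw [volume_lowerPart _ _ _ _ hL.le, ENNReal.ofReal_ne_zero_iff]
        have : 0 < L ^ p := Real.rpow_pos_of_pos hL p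
        norm_num; positivity
      · rw [volume_lowerPart _ _ _ _ hL.le]; finiteness
      · refine le_trans (le_of_eq ?_) ((hC x t L hL).trans_eq ?_)
        · congr 1
          refine laverage_congr (ae_restrict_of_ae ?_)
          filter_upwards [hwv] with z hz
          rw [hz]
        · congr 1
          exact laverage_congr (ae_restrict_of_ae hwv))
  obtain ⟨δ, hδ, hKθ⟩ := exists_rpow_mul_lt_one hK hθ
  exact ⟨1 + δ⁻¹, by linarith [inv_pos.2 hδ], hw,
    muckenhouptConst_lt_top_of_decay hγ1 hv hwv hκ0 hκ hK1 hK hC' hdecay hδ hKθ⟩
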